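/- Let $d\ge 1$, $\varepsilon>0$, $C(x,y)=\|x-y\|^2$ on $\mathbb R^d\times\mathbb R^d$, and let $\mathcal G(\mathbb R^d)$ be the set of sub-Gaussian probability measures on $\mathbb R^d$, i.e. of those $\mu$ for which $\int e^{\|x\|^2/(2d\sigma^2)}\,d\mu(x)\le 2$ for some $\sigma>0$. For $\alpha,\beta\in\mathcal G(\mathbb R^d)$ let $$\mathrm{OT}_\varepsilon^{\otimes}(\alpha,\beta)=\inf_{\pi\in\Pi(\alpha,\beta)}\int C\,d\pi+\varepsilon\,\mathrm{KL}(\pi\,|\,\alpha\otimes\beta),$$ where $\Pi(\alpha,\beta)$ is the set of couplings of $\alpha$ and $\beta$. Let $\alpha,\beta\in\mathcal G(\mathbb R^d)$. Then $\mathrm{OT}_\varepsilon^{\otimes}(\alpha,\beta)$ is finite, and $\mathrm{OT}_\varepsilon^{\otimes}$ is differentiable at $(\alpha,\beta)$ with $$\nabla\mathrm{OT}_\varepsilon^{\otimes}(\alpha,\beta)=(f,g),$$ where $f,g:\mathbb R^d\to\mathbb R$ satisfy the Sinkhorn (Schrödinger) fixed-point system on all of $\mathbb R^d$: $$e^{f(x)/\varepsilon}\int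 e^{(g(y)-C(x,y))/\varepsilon}\,d\beta(y)=1\quad\text{and}\quad e^{g(y)/\varepsilon}\int e^{(f(x)-C(x,y))/\varepsilon}\,d\alpha(x)=1\qquad\text{for all }x,y\in\mathbb R^d .$$ That is: this system has a solution, and for every solution $(f,g)$ the functions $f$ and $g$ are continuous, are integrable with respect to every $\mu\in\mathcal G(\mathbb R^d)$, and for all displacements $\delta\alpha=\alpha_1-\alpha_2$ and $\delta\beta=\beta_1-\beta_2$ with probability measures $\alpha_1,\alpha_2,\beta_1,\beta_2$ on $\mathbb R^d$, $$\mathrm{OT}_\varepsilon^{\otimes}(\alpha+t\,\delta\alpha,\beta+t\,\delta\beta)=\mathrm{OT}_\varepsilon^{\otimes}(\alpha,\beta)+t\Big(\int f\,d\delta\alpha+\int g\,d\delta\beta\Big)+o(t)$$ as $t\to0$ among those $t$ for which $\alpha+t\,\delta\alpha$ and $\beta+t\,\delta\beta$ belong to $\mathcal G(\mathbb R^d)$. -/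

import Mathlib

open MeasureTheory InformationTheory

open scoped ENNReal

namespace SinkhornOT

noncomputable section

/-- `ℝ^d` with its Euclidean norm. -/
abbrev Rd (d : ℕ) : Type := EuclideanSpace ℝ (Fin d)

/-- `μ` is `σ`-sub-Gaussian: `E_μ exp (‖X‖² / (2 d σ²)) ≤ 2`. -/
def IsSubGaussianWith {d : ℕ} (σ : ℝ) (μ : ProbabilityMeasure (Rd d)) : Prop :=
  ∫⁻ x, ENNReal.ofReal (Real.exp (‖x‖ ^ 2 / (2 * d * σ ^ 2))) ∂(μ : Measure (Rd d)) ≤ 2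

/-- The set `𝒢(ℝ^d)` of all sub-Gaussian probability measures on `ℝ^d`. -/
def subGaussian (d : ℕ) : Set (ProbabilityMeasure (Rd d)) :=
  {μ | ∃ σ : ℝ, 0 < σ ∧ IsSubGaussianWith σ μ}

/-- The quadratic ground cost `C(x, y) = ‖x - y‖²`. -/
def cost {d : ℕ} (x y : Rd d) : ℝ := ‖x - y‖ ^ 2

/-- The kernel `K(x, y) = exp (-C(x, y) / ε)`. -/
def gibbs {d : ℕ} (ε : ℝ) (x y : Rd d) : ℝ := Real.exp (-cost x y / ε)

/-- The transport plans `Π(α, β)`: measures on the product with marginals `α` and `β`. -/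
def plans {d : ℕ} (α β : ProbabilityMeasure (Rd d)) : Set (Measure (Rd d × Rd d)) :=
  {π | π.fst = (α : Measure (Rd d)) ∧ π.snd = (β : Measure (Rd d))}

/-- Entropic optimal transport with the product reference measure:
`inf_{π ∈ Π(α, β)} ∫ C dπ + ε KL(π | α ⊗ β)`, as an extended nonnegative number. -/
def entropicOT {d : ℕ} (ε : ℝ) (α β : ProbabilityMeasure (Rd d)) : ℝ≥0∞ :=
  ⨅ π ∈ plans α β,
    (∫⁻ z, ENNReal.ofReal (cost z.1 z.2) ∂π)
      + ENNReal.ofReal ε * klDiv π ((α : Measure (Rd d)).prod (β : Measure (Rd d)))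

/-- The Sinkhorn (Schrödinger) fixed-point system, required at every point of `ℝ^d`:
`e^{f/ε} · K(e^{g/ε} β) = 1` and `e^{g/ε} · Kᵀ(e^{f/ε} α) = 1`. Since each product equals `1`, the
integrals are automatically nonzero, hence convergent. -/
def SchrodingerSystem {d : ℕ} (ε : ℝ) (α β : ProbabilityMeasure (Rd d)) (f g : Rd d → ℝ) : Prop :=
  (∀ x, Real.exp (f x / ε)
      * ∫ y, gibbs ε x y * Real.exp (g y / ε) ∂(β : Measure (Rd d)) = 1) ∧
  (∀ y, Real.exp (g y / ε)
      * ∫ x, gibbs ε x y * Real.exp (f x / ε) ∂(α : Measure (Rd d)) = 1)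

/-- A probability measure seen as a signed measure. -/
def signed {d : ℕ} (μ : ProbabilityMeasure (Rd d)) : SignedMeasure (Rd d) :=
  (μ : Measure (Rd d)).toSignedMeasure

/-- The pairing `⟨η, f⟩ = ∫ f dη` of a finite signed measure with a function, computed through the
Jordan decomposition of `η`. -/
def pairing {d : ℕ} (η : SignedMeasure (Rd d)) (f : Rd d → ℝ) : ℝ :=
  ∫ x, f x ∂η.toJordanDecomposition.posPart - ∫ x, f x ∂η.toJordanDecomposition.negPart

/-- `(f, g)` is a gradient at `(α, β)`, along feasible directions, of a function `F` of two
probability measures that is considered on `S × S`: `f` and `g` are continuous and integrable for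
every member of `S`, and for all displacements `δα = α₁ - α₂` and `δβ = β₁ - β₂` of probability
measures
`F (α + t δα, β + t δβ) = F (α, β) + t (⟨δα, f⟩ + ⟨δβ, g⟩) + o(t)`
as `t → 0` among the `t` for which `α + t δα` and `β + t δβ` are members of `S`
(here `α'` and `β'` are these two displaced measures). -/
def IsGradientAt {d : ℕ} (S : Set (ProbabilityMeasure (Rd d)))
    (F : ProbabilityMeasure (Rd d) → ProbabilityMeasure (Rd d) → ℝ)
    (α β : ProbabilityMeasure (Rd d)) (f g : Rd d → ℝ) : Prop :=
  Continuous f ∧ Continuous g ∧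
  (∀ μ ∈ S, Integrable f (μ : Measure (Rd d)) ∧ Integrable g (μ : Measure (Rd d))) ∧
  ∀ α₁ α₂ β₁ β₂ : ProbabilityMeasure (Rd d), ∀ c : ℝ, 0 < c → ∃ r : ℝ, 0 < r ∧
    ∀ t : ℝ, |t| < r → ∀ α' ∈ S, ∀ β' ∈ S,
      signed α' = signed α + t • (signed α₁ - signed α₂) →
      signed β' = signed β + t • (signed β₁ - signed β₂) →
      |F α' β' - F α β
          - t * (pairing (signed α₁ - signed α₂) f + pairing (signed β₁ - signed β₂) g)|
        ≤ c * |t|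

end

end SinkhornOT

/-! Put u = f/ε, v = g/ε and c = ‖x - y‖²/ε. The Schrödinger system becomes u = T_β v, v = T_α u,
where T is `softTransform`. The dual objective D(u, v) = ∫ u dα + ∫ v dβ + 1 - ∫∫ exp(u + v - c) is
concave, its maximizer in one variable is a soft transform of the other, and at a solution ε D
equals the transport cost (`entropicOT_eq`).

Growth is controlled by the class `Tame`. Its upper bound has the same leading term ‖x‖²/ε as the
cost, so u - c(·, y) grows at most linearly from above and exp(u - c(·, y)) is integrable against
every sub-Gaussian measure, however large its parameter is compared with ε. Jensen's inequality
returns the same leading term for T u, so the class is stable.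

Compactness comes from one identity, `eLpNorm_sqrt_density_sub`: the squared L² distance of the
square roots of two Gibbs densities is the concavity defect 2 D(midpoint) - D - D'. Hence fast
maximizing sequences have almost everywhere convergent sums u + v. After separating the two
variables, soft transforms give convergence everywhere; this yields solutions with bounds depending
on moments only (`exists_potentialPair`), and stability of solutions up to an additive constant
(`exists_subseq_tendsto_potentials`).

For the derivative, a feasible displacement is a mixture (1 - s) α + s α', and likewise for β.
Testing the displaced problem with an update of the base potentials bounds the cost below to first
order (`dualValue_mix_ge`). Testing the base problem with the displaced potentials bounds it above,
with a remainder quadratic in s up to the factor ∫ exp(U + V - c) d(α' ⊗ β') (`dualValue_base_eq`),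
which is o(1/s) (`tendsto_mul_integral_density`). Stability identifies the two first-order terms. -/

namespace SinkhornOT

open Filter Topology

/-! ### Tame potentials and square-exponential moments -/

section

variable {d : ℕ}

/-- The quadratic cost in units of the temperature `ε`. -/
noncomputable def scaledCost (ε : ℝ) (x y : Rd d) : ℝ := ‖x - y‖ ^ 2 / ε

/-- The soft transform `y ↦ -log ∫ exp (u x - c (x, y)) dμ(x)`. -/
noncomputable def softTransform (ε : ℝ) (μ : Measure (Rd d)) (u : Rd d → ℝ) (y : Rd d) : ℝ :=
  -Real.log (∫ x, Real.exp (u x - scaledCost ε x y) ∂μ)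

/-- A quantitative form of sub-Gaussianity. -/
structure HasExpSqMoment (η M : ℝ) (μ : Measure (Rd d)) : Prop where
  integrable : Integrable (fun x => Real.exp (η * ‖x‖ ^ 2)) μ
  le : ∫ x, Real.exp (η * ‖x‖ ^ 2) ∂μ ≤ M

/-- Potentials growing at most as the cost from above, and quadratically from below. -/
structure Tame (ε K : ℝ) (u : Rd d → ℝ) : Prop where
  measurable : Measurable u
  lower : ∀ x, -(K * (1 + ‖x‖ ^ 2)) ≤ u x
  upper : ∀ x, u x ≤ ‖x‖ ^ 2 / ε + K * (1 + ‖x‖)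

lemma scaledCost_comm (ε : ℝ) (x y : Rd d) : scaledCost ε x y = scaledCost ε y x := by
  simp [scaledCost, norm_sub_rev]

lemma continuous_scaledCost (ε : ℝ) :
    Continuous (fun z : Rd d × Rd d => scaledCost ε z.1 z.2) := by
  unfold scaledCost; fun_prop

lemma measurable_scaledCost {X : Type*} [MeasurableSpace X] (ε : ℝ) {f g : X → Rd d}
    (hf : Measurable f) (hg : Measurable g) : Measurable (fun z => scaledCost ε (f z) (g z)) :=
  ((hf.sub hg).norm.pow_const 2).div_const ε

lemma scaledCost_nonneg {ε : ℝ} (hε : 0 < ε) (x y : Rd d) : 0 ≤ scaledCost ε x y := by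
  unfold scaledCost; positivity

lemma scaledCost_le {ε : ℝ} (hε : 0 < ε) (x y : Rd d) :
    scaledCost ε x y ≤ (‖x‖ ^ 2 + 2 * ‖x‖ * ‖y‖ + ‖y‖ ^ 2) / ε := by
  unfold scaledCost
  gcongr
  nlinarith [norm_sub_le x y, norm_nonneg (x - y), norm_nonneg x, norm_nonneg y]

lemma le_scaledCost {ε : ℝ} (hε : 0 < ε) (x y : Rd d) :
    (‖x‖ ^ 2 - 2 * ‖x‖ * ‖y‖ + ‖y‖ ^ 2) / ε ≤ scaledCost ε x y := by
  unfold scaledCost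
  gcongr
  have := abs_norm_sub_norm_le x y
  nlinarith [sq_abs (‖x‖ - ‖y‖), abs_nonneg (‖x‖ - ‖y‖), norm_nonneg (x - y)]

lemma Tame.nonneg {ε K : ℝ} {u : Rd d → ℝ} (hu : Tame ε K u) : 0 ≤ K := by
  have h1 := hu.lower 0
  have h2 := hu.upper 0
  simp at h1 h2
  linarith

lemma Tame.mono {ε K L : ℝ} {u : Rd d → ℝ} (hu : Tame ε K u) (h : K ≤ L) : Tame ε L u := by
  refine ⟨hu.measurable, fun x => ?_, fun x => ?_⟩
  · refine le_trans ?_ (hu.lower x)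
    gcongr
  · refine (hu.upper x).trans ?_
    gcongr

lemma Tame.add_const {ε K : ℝ} {u : Rd d → ℝ} (hu : Tame ε K u) (a : ℝ) :
    Tame ε (K + |a|) (fun x => u x + a) := by
  refine ⟨hu.measurable.add_const a, fun x => ?_, fun x => ?_⟩
  · nlinarith [hu.lower x, neg_abs_le a, abs_nonneg a, sq_nonneg ‖x‖,
      mul_nonneg (abs_nonneg a) (sq_nonneg ‖x‖)]
  · nlinarith [hu.upper x, le_abs_self a, abs_nonneg a, norm_nonneg x,
      mul_nonneg (abs_nonneg a) (norm_nonneg x)]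

lemma Tame.abs_le {ε K : ℝ} (hε : 0 < ε) {u : Rd d → ℝ} (hu : Tame ε K u) (x : Rd d) :
    |u x| ≤ (2 * K + 1 / ε) * (1 + ‖x‖ ^ 2) := by
  have hK := hu.nonneg
  have h1 : 0 ≤ 1 / ε := by positivity
  rw [_root_.abs_le]
  constructor
  · nlinarith [hu.lower x, sq_nonneg ‖x‖, mul_nonneg h1 (sq_nonneg ‖x‖),
      mul_nonneg hK (sq_nonneg ‖x‖)]
  · have h2 : ‖x‖ ^ 2 / ε = 1 / ε * ‖x‖ ^ 2 := by ring
    have h3 : ‖x‖ ≤ 1 + ‖x‖ ^ 2 := by nlinarith [sq_nonneg (‖x‖ - 1)]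
    have h4 := mul_le_mul_of_nonneg_left h3 hK
    have := hu.upper x
    rw [h2] at this
    nlinarith [mul_nonneg hK (sq_nonneg ‖x‖)]

lemma Tame.convex_comb {ε K L : ℝ} {u v : Rd d → ℝ} (hu : Tame ε K u) (hv : Tame ε L v) :
    Tame ε (K + L) (fun x => (u x + v x) / 2) := by
  have hK := hu.nonneg
  have hL := hv.nonneg
  refine ⟨(hu.measurable.add hv.measurable).div_const 2, fun x => ?_, fun x => ?_⟩
  · nlinarith [hu.lower x, hv.lower x, sq_nonneg ‖x‖, mul_nonneg hK (sq_nonneg ‖x‖),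
      mul_nonneg hL (sq_nonneg ‖x‖)]
  · nlinarith [hu.upper x, hv.upper x, norm_nonneg x, mul_nonneg hK (norm_nonneg x),
      mul_nonneg hL (norm_nonneg x)]

lemma tame_zero {ε : ℝ} (hε : 0 < ε) : Tame ε 0 (fun _ : Rd d => (0 : ℝ)) :=
  ⟨measurable_const, fun x => by simp, fun x => by simp; positivity⟩

namespace HasExpSqMoment

variable {η M : ℝ} {μ ν : Measure (Rd d)}

lemma one_le [IsProbabilityMeasure μ] (h : HasExpSqMoment η M μ) (hη : 0 < η) : 1 ≤ M := by
  refine le_trans ?_ h.le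
  calc (1 : ℝ) = ∫ _, (1 : ℝ) ∂μ := by simp
    _ ≤ _ := integral_mono (integrable_const _) h.integrable
        (fun x => Real.one_le_exp (by positivity))

lemma mono_exponent {η' : ℝ} (h : HasExpSqMoment η M μ) (hη : η' ≤ η) :
    HasExpSqMoment η' M μ := by
  have hle : ∀ x : Rd d, Real.exp (η' * ‖x‖ ^ 2) ≤ Real.exp (η * ‖x‖ ^ 2) := fun x => by gcongr
  have hi : Integrable (fun x => Real.exp (η' * ‖x‖ ^ 2)) μ := by
    refine h.integrable.mono' (by fun_prop) (ae_of_all _ fun x => ?_)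
    rw [Real.norm_of_nonneg (Real.exp_nonneg _)]
    exact hle x
  exact ⟨hi, (integral_mono hi h.integrable hle).trans h.le⟩

lemma integrable_sq (h : HasExpSqMoment η M μ) (hη : 0 < η) :
    Integrable (fun x => ‖x‖ ^ 2) μ := by
  refine (h.integrable.const_mul η⁻¹).mono' (by fun_prop) (ae_of_all _ fun x => ?_)
  rw [Real.norm_of_nonneg (by positivity), inv_mul_eq_div, le_div_iff₀ hη]
  linarith [Real.add_one_le_exp (η * ‖x‖ ^ 2)]

lemma integral_sq_le (h : HasExpSqMoment η M μ) (hη : 0 < η) :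
    ∫ x, ‖x‖ ^ 2 ∂μ ≤ M / η := by
  rw [div_eq_inv_mul]
  refine le_trans ?_ (mul_le_mul_of_nonneg_left h.le (by positivity))
  rw [← integral_const_mul]
  refine integral_mono (h.integrable_sq hη) (h.integrable.const_mul _) fun x => ?_
  simp only
  rw [inv_mul_eq_div, le_div_iff₀ hη]
  linarith [Real.add_one_le_exp (η * ‖x‖ ^ 2)]

lemma integrable_of_abs_le [IsFiniteMeasure μ] (h : HasExpSqMoment η M μ) (hη : 0 < η) {K : ℝ}
    {u : Rd d → ℝ} (hm : AEStronglyMeasurable u μ) (hu : ∀ x, |u x| ≤ K * (1 + ‖x‖ ^ 2)) :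
    Integrable u μ := by
  refine (((integrable_const (1 : ℝ)).add (h.integrable_sq hη)).const_mul K).mono' hm
    (ae_of_all _ fun x => ?_)
  simpa using hu x

lemma abs_integral_le [IsProbabilityMeasure μ] (h : HasExpSqMoment η M μ) (hη : 0 < η) {K : ℝ}
    (hK : 0 ≤ K) {u : Rd d → ℝ} (hu : ∀ x, |u x| ≤ K * (1 + ‖x‖ ^ 2)) :
    |∫ x, u x ∂μ| ≤ K * (1 + M / η) := by
  have hi := ((integrable_const (μ := μ) (1 : ℝ)).add (h.integrable_sq hη)).const_mul K
  refine (norm_integral_le_of_norm_le (f := u) hi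
    (ae_of_all _ fun x => by simpa using hu x)).trans ?_
  rw [integral_const_mul]
  refine mul_le_mul_of_nonneg_left ?_ hK
  rw [integral_add' (integrable_const 1) (h.integrable_sq hη)]
  simpa using h.integral_sq_le hη

end HasExpSqMoment

lemma Tame.integrable {ε K η M : ℝ} (hε : 0 < ε) (hη : 0 < η) {μ : Measure (Rd d)}
    [IsFiniteMeasure μ] (hμ : HasExpSqMoment η M μ) {u : Rd d → ℝ} (hu : Tame ε K u) :
    Integrable u μ :=
  hμ.integrable_of_abs_le hη hu.measurable.aestronglyMeasurable (hu.abs_le hε)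

/-- The quadratic terms of the bound on u and of the cost cancel; the linear remainder is absorbed
by Young's inequality into η‖x‖² with η as small as desired. Uniformity over ‖y‖ ≤ r makes this a
dominating function near a given y. -/
lemma exp_sub_scaledCost_le {ε K η r : ℝ} (hε : 0 < ε) (hη : 0 < η) {u : Rd d → ℝ}
    (hu : ∀ x, u x ≤ ‖x‖ ^ 2 / ε + K * (1 + ‖x‖)) (x : Rd d) {y : Rd d}
    (hy : ‖y‖ ≤ r) :
    Real.exp (u x - scaledCost ε x y) ≤
      Real.exp (K + K ^ 2 / (2 * η) + 2 * r ^ 2 / (ε ^ 2 * η)) * Real.exp (η * ‖x‖ ^ 2) := by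
  rw [← Real.exp_add]
  gcongr
  have h1 := hu x
  have h2 := le_scaledCost hε x y
  have h3 : (K + 2 * r / ε) * ‖x‖ ≤
      η * ‖x‖ ^ 2 + K ^ 2 / (2 * η) + 2 * r ^ 2 / (ε ^ 2 * η) := by
    have e1 : K ^ 2 / (2 * η) = η * 2 * (K / (2 * η)) ^ 2 := by field_simp
    have e2 : 2 * r ^ 2 / (ε ^ 2 * η) = η * 2 * (2 * r / ε / (2 * η)) ^ 2 := by field_simp
    have e3 : (K + 2 * r / ε) = 2 * η * (K / (2 * η) + 2 * r / ε / (2 * η)) := by field_simp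
    rw [e1, e2, e3]
    nlinarith [mul_nonneg hη.le (sq_nonneg (‖x‖ - K / (2 * η) - 2 * r / ε / (2 * η))),
      mul_nonneg hη.le (sq_nonneg (K / (2 * η) - 2 * r / ε / (2 * η)))]
  have h4 : ‖x‖ ^ 2 / ε - (‖x‖ ^ 2 - 2 * ‖x‖ * ‖y‖ + ‖y‖ ^ 2) / ε ≤ 2 * r / ε * ‖x‖ := by
    rw [← sub_div, div_mul_eq_mul_div]
    gcongr
    nlinarith [mul_le_mul_of_nonneg_left hy (norm_nonneg x), sq_nonneg ‖y‖]
  linarith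

/-! ### The soft transform on tame potentials -/

section Transform

variable {ε K η M : ℝ} {μ : Measure (Rd d)} {u : Rd d → ℝ}

lemma integrable_exp_sub_scaledCost (hε : 0 < ε) (hη : 0 < η) (hμ : HasExpSqMoment η M μ)
    (hm : AEStronglyMeasurable u μ) 
    (hu : ∀ x, u x ≤ ‖x‖ ^ 2 / ε + K * (1 + ‖x‖)) (y : Rd d) :
    Integrable (fun x => Real.exp (u x - scaledCost ε x y)) μ := by
  refine (hμ.integrable.const_mul
    (Real.exp (K + K ^ 2 / (2 * η) + 2 * ‖y‖ ^ 2 / (ε ^ 2 * η)))).mono' ?_ (ae_of_all _ fun x => ?_)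
  · exact Real.continuous_exp.comp_aestronglyMeasurable (hm.sub
      (measurable_scaledCost ε measurable_id measurable_const).aestronglyMeasurable)
  · exact Real.norm_of_nonneg (Real.exp_nonneg _) |>.trans_le
      (exp_sub_scaledCost_le hε hη hu x (le_refl ‖y‖))

lemma integral_exp_sub_scaledCost_le (hε : 0 < ε) (hη : 0 < η) (hμ : HasExpSqMoment η M μ)
    (hu : ∀ x, u x ≤ ‖x‖ ^ 2 / ε + K * (1 + ‖x‖)) (y : Rd d) :
    ∫ x, Real.exp (u x - scaledCost ε x y) ∂μ ≤
      Real.exp (K + K ^ 2 / (2 * η) + 2 * ‖y‖ ^ 2 / (ε ^ 2 * η)) * M := by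
  refine le_trans ?_ (mul_le_mul_of_nonneg_left hμ.le (Real.exp_nonneg _))
  rw [← integral_const_mul]
  refine integral_mono_of_nonneg (ae_of_all _ fun x => Real.exp_nonneg _)
    (hμ.integrable.const_mul _) (ae_of_all _ fun x => ?_)
  exact exp_sub_scaledCost_le hε hη hu x (le_refl ‖y‖)

lemma tendsto_integral_exp_sub_scaledCost (hε : 0 < ε) (hη : 0 < η)
    (hμ : HasExpSqMoment η M μ) {U : ℕ → Rd d → ℝ} {w : Rd d → ℝ}
    (hU : ∀ n, Tame ε K (U n)) (h : ∀ᵐ x ∂μ, Tendsto (fun n => U n x) atTop (𝓝 (w x)))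
    (y : Rd d) :
    Tendsto (fun n => ∫ x, Real.exp (U n x - scaledCost ε x y) ∂μ) atTop
      (𝓝 (∫ x, Real.exp (w x - scaledCost ε x y) ∂μ)) := by
  refine tendsto_integral_of_dominated_convergence
    (fun x => Real.exp (K + K ^ 2 / (2 * η) + 2 * ‖y‖ ^ 2 / (ε ^ 2 * η)) *
      Real.exp (η * ‖x‖ ^ 2)) (fun n => ?_) (hμ.integrable.const_mul _)
    (fun n => ae_of_all _ fun x => ?_) ?_
  · exact (integrable_exp_sub_scaledCost hε hη hμ (hU n).measurable.aestronglyMeasurable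
      (hU n).upper y).aestronglyMeasurable
  · exact Real.norm_of_nonneg (Real.exp_nonneg _) |>.trans_le
      (exp_sub_scaledCost_le hε hη (hU n).upper x (le_refl ‖y‖))
  · filter_upwards [h] with x hx
    exact (Real.continuous_exp.tendsto _).comp (hx.sub_const _)

lemma Tame.integrable_exp (hε : 0 < ε) (hη : 0 < η) (hμ : HasExpSqMoment η M μ)
    (hu : Tame ε K u) (y : Rd d) :
    Integrable (fun x => Real.exp (u x - scaledCost ε x y)) μ :=
  integrable_exp_sub_scaledCost hε hη hμ hu.measurable.aestronglyMeasurable hu.upper y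

lemma softTransform_add_const (a : ℝ) (y : Rd d)
    (hpos : 0 < ∫ x, Real.exp (u x - scaledCost ε x y) ∂μ) :
    softTransform ε μ (fun x => u x + a) y = softTransform ε μ u y - a := by
  have : ∀ x, Real.exp (u x + a - scaledCost ε x y) =
      Real.exp a * Real.exp (u x - scaledCost ε x y) := fun x => by
    rw [← Real.exp_add]; ring_nf
  simp only [softTransform, this]
  rw [integral_const_mul, Real.log_mul (Real.exp_pos _).ne' hpos.ne', Real.log_exp]
  ring

variable [IsProbabilityMeasure μ]

lemma integral_exp_sub_scaledCost_pos (hε : 0 < ε) (hη : 0 < η) (hμ : HasExpSqMoment η M μ)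
    (hm : AEStronglyMeasurable u μ) 
    (hu : ∀ x, u x ≤ ‖x‖ ^ 2 / ε + K * (1 + ‖x‖)) (y : Rd d) :
    0 < ∫ x, Real.exp (u x - scaledCost ε x y) ∂μ :=
  integral_exp_pos (integrable_exp_sub_scaledCost hε hη hμ hm hu y)

lemma exp_neg_softTransform (hε : 0 < ε) (hη : 0 < η) (hμ : HasExpSqMoment η M μ)
    (hm : AEStronglyMeasurable u μ) 
    (hu : ∀ x, u x ≤ ‖x‖ ^ 2 / ε + K * (1 + ‖x‖)) (y : Rd d) :
    Real.exp (-softTransform ε μ u y) = ∫ x, Real.exp (u x - scaledCost ε x y) ∂μ := by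
  rw [softTransform, neg_neg, Real.exp_log (integral_exp_sub_scaledCost_pos hε hη hμ hm hu y)]

lemma continuous_softTransform (hε : 0 < ε) (hη : 0 < η) (hμ : HasExpSqMoment η M μ)
    (hm : AEStronglyMeasurable u μ) 
    (hu : ∀ x, u x ≤ ‖x‖ ^ 2 / ε + K * (1 + ‖x‖)) :
    Continuous (softTransform ε μ u) := by
  refine Continuous.neg (Continuous.log ?_ fun y =>
    (integral_exp_sub_scaledCost_pos hε hη hμ hm hu y).ne')
  refine continuous_iff_continuousAt.2 fun y₀ => ?_
  refine continuousAt_of_dominated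
    (bound := fun x => Real.exp (K + K ^ 2 / (2 * η) + 2 * (‖y₀‖ + 1) ^ 2 / (ε ^ 2 * η)) *
      Real.exp (η * ‖x‖ ^ 2)) ?_ ?_ (hμ.integrable.const_mul _) ?_
  · exact Eventually.of_forall fun y =>
      (integrable_exp_sub_scaledCost hε hη hμ hm hu y).aestronglyMeasurable
  · filter_upwards [Metric.ball_mem_nhds y₀ one_pos] with y hy
    refine ae_of_all _ fun x => Real.norm_of_nonneg (Real.exp_nonneg _) |>.trans_le
      (exp_sub_scaledCost_le hε hη hu x ?_)
    have : ‖y - y₀‖ < 1 := by simpa [dist_eq_norm] using hy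
    linarith [norm_le_norm_add_norm_sub' y y₀]
  · refine ae_of_all _ fun x => Continuous.continuousAt ?_
    unfold scaledCost
    fun_prop

lemma softTransform_ge (hε : 0 < ε) (hη : 0 < η) (hμ : HasExpSqMoment η M μ)
    (hm : AEStronglyMeasurable u μ) (hK : 0 ≤ K)
    (hu : ∀ x, u x ≤ ‖x‖ ^ 2 / ε + K * (1 + ‖x‖)) (y : Rd d) :
    -((Real.log M + K + K ^ 2 / (2 * η) + 2 / (ε ^ 2 * η)) * (1 + ‖y‖ ^ 2)) ≤
      softTransform ε μ u y := by
  have hM := hμ.one_le hη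
  have hlM := Real.log_nonneg hM
  have h := Real.log_le_log (integral_exp_sub_scaledCost_pos hε hη hμ hm hu y)
    (integral_exp_sub_scaledCost_le hε hη hμ hu y)
  rw [Real.log_mul (Real.exp_pos _).ne' (by positivity), Real.log_exp] at h
  rw [softTransform]
  have h1 : 0 ≤ K ^ 2 / (2 * η) := by positivity
  have h2 : 0 ≤ 2 / (ε ^ 2 * η) := by positivity
  have h3 : 2 * ‖y‖ ^ 2 / (ε ^ 2 * η) = 2 / (ε ^ 2 * η) * ‖y‖ ^ 2 := by ring
  have h4 : 0 ≤ (Real.log M + K + K ^ 2 / (2 * η)) * ‖y‖ ^ 2 := by positivity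
  rw [h3] at h
  nlinarith

lemma exp_integral_le {X : Type*} [MeasurableSpace X] {μ : Measure X} [IsProbabilityMeasure μ]
    {h : X → ℝ} (hi : Integrable h μ)
    (he : Integrable (fun x => Real.exp (h x)) μ) :
    Real.exp (∫ x, h x ∂μ) ≤ ∫ x, Real.exp (h x) ∂μ :=
  convexOn_exp.map_integral_le Real.continuous_exp.continuousOn isClosed_univ
    (ae_of_all _ fun _ => Set.mem_univ _) hi he

lemma integrable_scaledCost (hε : 0 < ε) (hη : 0 < η) (hμ : HasExpSqMoment η M μ) (y : Rd d) :
    Integrable (fun x => scaledCost ε x y) μ := by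
  refine hμ.integrable_of_abs_le (K := (2 + 2 * ‖y‖ ^ 2) / ε) hη
    (measurable_scaledCost ε measurable_id measurable_const).aestronglyMeasurable fun x => ?_
  rw [abs_of_nonneg (scaledCost_nonneg hε x y), div_mul_eq_mul_div]
  refine (scaledCost_le hε x y).trans ?_
  gcongr
  nlinarith [sq_nonneg (‖x‖ - ‖y‖), sq_nonneg (‖x‖ * ‖y‖), sq_nonneg ‖x‖, sq_nonneg ‖y‖]

/-- The coefficient of ‖y‖² has to be exactly 1/ε, so the cross term ‖x‖‖y‖ is bounded by a multiple
of ‖y‖(1 + ‖x‖²), which is only linear in ‖y‖. -/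
lemma integral_scaledCost_le (hε : 0 < ε) (hη : 0 < η) (hμ : HasExpSqMoment η M μ) (y : Rd d) :
    ∫ x, scaledCost ε x y ∂μ ≤ ‖y‖ ^ 2 / ε + 2 * (1 + M / η) / ε * (1 + ‖y‖) := by
  have hi : Integrable (fun x : Rd d =>
      (1 + 2 * ‖y‖) / ε * ‖x‖ ^ 2 + (2 * ‖y‖ + ‖y‖ ^ 2) / ε) μ :=
    ((hμ.integrable_sq hη).const_mul _).add (integrable_const _)
  calc ∫ x, scaledCost ε x y ∂μ
      ≤ ∫ x, ((1 + 2 * ‖y‖) / ε * ‖x‖ ^ 2 + (2 * ‖y‖ + ‖y‖ ^ 2) / ε) ∂μ := by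
        refine integral_mono (integrable_scaledCost hε hη hμ y) hi fun x => ?_
        refine (scaledCost_le hε x y).trans ?_
        rw [div_mul_eq_mul_div, ← add_div]
        refine (div_le_div_iff_of_pos_right hε).2 ?_
        nlinarith [mul_nonneg (norm_nonneg y) (sq_nonneg (‖x‖ - 1)), norm_nonneg y,
          mul_nonneg (norm_nonneg y) (sq_nonneg ‖x‖)]
    _ = (1 + 2 * ‖y‖) / ε * (∫ x, ‖x‖ ^ 2 ∂μ) + (2 * ‖y‖ + ‖y‖ ^ 2) / ε := by
        rw [integral_add ((hμ.integrable_sq hη).const_mul _) (integrable_const _),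
          integral_const_mul]
        simp
    _ ≤ (1 + 2 * ‖y‖) / ε * (M / η) + (2 * ‖y‖ + ‖y‖ ^ 2) / ε := by
        gcongr
        exact hμ.integral_sq_le hη
    _ ≤ _ := by
        rw [div_mul_eq_mul_div, div_mul_eq_mul_div, ← add_div, ← add_div]
        refine (div_le_div_iff_of_pos_right hε).2 ?_
        have := hμ.one_le hη
        have : 0 ≤ M / η := by positivity
        nlinarith [norm_nonneg y]

/-- Jensen's inequality for the exponential. -/
lemma softTransform_le_integral (hε : 0 < ε) (hη : 0 < η) (hμ : HasExpSqMoment η M μ)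
    (hu : Tame ε K u) (y : Rd d) :
    softTransform ε μ u y ≤ ∫ x, scaledCost ε x y ∂μ - ∫ x, u x ∂μ := by
  have hm := hu.measurable.aestronglyMeasurable (μ := μ)
  have h := exp_integral_le ((hu.integrable hε hη hμ).sub (integrable_scaledCost hε hη hμ y))
    (integrable_exp_sub_scaledCost hε hη hμ hm hu.upper y)
  have h2 := Real.log_le_log (Real.exp_pos _) h
  simp only [Real.log_exp, Pi.sub_apply] at h2
  rw [integral_sub (hu.integrable hε hη hμ) (integrable_scaledCost hε hη hμ y)] at h2
  rw [softTransform]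
  linarith

/-- The constant in `tame_softTransform`. -/
noncomputable def transformBound (ε η M K : ℝ) : ℝ :=
  (Real.log M + K + K ^ 2 / (2 * η) + 2 / (ε ^ 2 * η)) + (2 * (1 + M / η) / ε + K)

/-- The constant L serves only for measurability and integrability; the output depends on K, that is
on the upper bound and the mean of u. A potential without a uniform pointwise lower bound thus still
gets a uniformly tame transform. -/
lemma tame_softTransform {L : ℝ} (hε : 0 < ε) (hη : 0 < η) (hμ : HasExpSqMoment η M μ)
    (hu : Tame ε L u) (hK : 0 ≤ K) (hup : ∀ x, u x ≤ ‖x‖ ^ 2 / ε + K * (1 + ‖x‖))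
    (hint : -K ≤ ∫ x, u x ∂μ) :
    Tame ε (transformBound ε η M K) (softTransform ε μ u) := by
  have hm := hu.measurable.aestronglyMeasurable (μ := μ)
  have hM := hμ.one_le hη
  have hlM := Real.log_nonneg hM
  have p1 : 0 ≤ Real.log M + K + K ^ 2 / (2 * η) + 2 / (ε ^ 2 * η) := by positivity
  have p2 : 0 ≤ 2 * (1 + M / η) / ε + K := by positivity
  refine ⟨(continuous_softTransform hε hη hμ hm hup).measurable, fun y => ?_, fun y => ?_⟩
  · refine le_trans ?_ (softTransform_ge hε hη hμ hm hK hup y)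
    unfold transformBound
    nlinarith [mul_nonneg p2 (sq_nonneg ‖y‖)]
  · refine (softTransform_le_integral hε hη hμ hu y).trans ?_
    have := integral_scaledCost_le hε hη hμ y
    unfold transformBound
    nlinarith [mul_nonneg p1 (norm_nonneg y), mul_nonneg hK (norm_nonneg y)]

lemma Tame.exists_tame_softTransform (hε : 0 < ε) (hη : 0 < η) (hμ : HasExpSqMoment η M μ)
    (hu : Tame ε K u) : ∃ L, Tame ε L (softTransform ε μ u) := by
  refine ⟨_, tame_softTransform hε hη hμ hu (K := max K |∫ x, u x ∂μ|)
    (hu.nonneg.trans (le_max_left _ _)) (fun x => (hu.upper x).trans ?_) ?_⟩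
  · gcongr
    exact le_max_left _ _
  · have := neg_abs_le (∫ x, u x ∂μ)
    have := le_max_right K |∫ x, u x ∂μ|
    linarith

lemma Tame.exp_neg_softTransform (hε : 0 < ε) (hη : 0 < η) (hμ : HasExpSqMoment η M μ)
    (hu : Tame ε K u) (y : Rd d) :
    Real.exp (-softTransform ε μ u y) = ∫ x, Real.exp (u x - scaledCost ε x y) ∂μ :=
  SinkhornOT.exp_neg_softTransform hε hη hμ hu.measurable.aestronglyMeasurable hu.upper y

lemma Tame.softTransform_add_const (hε : 0 < ε) (hη : 0 < η) (hμ : HasExpSqMoment η M μ)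
    (hu : Tame ε K u) (a : ℝ) :
    softTransform ε μ (fun x => u x + a) = fun y => softTransform ε μ u y - a :=
  funext fun y => SinkhornOT.softTransform_add_const a y
    (integral_exp_pos (hu.integrable_exp hε hη hμ y))

end Transform

end

/-! ### Gibbs densities and the dual objective -/

section

variable {d : ℕ}

/-- The Gibbs density `exp (u ⊕ v - c)`. -/
noncomputable def density (ε : ℝ) (u v : Rd d → ℝ) (z : Rd d × Rd d) : ℝ :=
  Real.exp (u z.1 + v z.2 - scaledCost ε z.1 z.2)

/-- The dual objective of entropic transport, in units of `ε`. -/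
noncomputable def dualValue (ε : ℝ) (μ ν : Measure (Rd d)) (u v : Rd d → ℝ) : ℝ :=
  ∫ x, u x ∂μ + ∫ y, v y ∂ν + 1 - ∫ z, density ε u v z ∂(μ.prod ν)

lemma density_pos (ε : ℝ) (u v : Rd d → ℝ) (z : Rd d × Rd d) : 0 < density ε u v z :=
  Real.exp_pos _

lemma measurable_density (ε : ℝ) {u v : Rd d → ℝ} (hu : Measurable u) (hv : Measurable v) :
    Measurable (density ε u v) :=
  (((hu.comp measurable_fst).add (hv.comp measurable_snd)).sub
    (measurable_scaledCost ε measurable_fst measurable_snd)).exp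

lemma density_swap (ε : ℝ) (u v : Rd d → ℝ) (z : Rd d × Rd d) :
    density ε u v z.swap = density ε v u z := by
  simp only [density, Prod.fst_swap, Prod.snd_swap, scaledCost_comm ε z.2]
  ring_nf

section Marginal

variable {ε : ℝ} {μ ν : Measure (Rd d)} {u v : Rd d → ℝ}

lemma integrable_density_swap [SFinite μ] [SFinite ν] (h : Integrable (density ε u v) (μ.prod ν)) :
    Integrable (density ε v u) (ν.prod μ) :=
  h.swap.congr (ae_of_all _ fun z => density_swap ε u v z)

lemma integral_density_swap [SFinite μ] [SFinite ν] (f : Rd d × Rd d → ℝ) :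
    ∫ z, density ε v u z * f z ∂(ν.prod μ) = ∫ z, density ε u v z * f z.swap ∂(μ.prod ν) := by
  rw [← integral_prod_swap]
  simp [density_swap]

lemma dualValue_swap [SFinite μ] [SFinite ν] : dualValue ε ν μ v u = dualValue ε μ ν u v := by
  have := integral_density_swap (ε := ε) (μ := μ) (ν := ν) (u := u) (v := v) (fun _ => 1)
  simp only [mul_one] at this
  rw [dualValue, dualValue, this]
  ring

/-- The second marginal of `density ε u v • (μ ⊗ ν)` is `ν`, pointwise. -/
def HasUnitMarginal (ε : ℝ) (μ : Measure (Rd d)) (u v : Rd d → ℝ) : Prop :=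
  ∀ y, ∫ x, density ε u v (x, y) ∂μ = 1

/-- A nonzero Bochner integral forces each slice to be integrable. As the marginal condition holds
at every point, ν is arbitrary; the derivative estimates rely on this freedom. -/
lemma HasUnitMarginal.integrable [SFinite μ] [IsFiniteMeasure ν] (h : HasUnitMarginal ε μ u v)
    (hu : Measurable u) (hv : Measurable v) : Integrable (density ε u v) (μ.prod ν) := by
  rw [integrable_prod_iff' (measurable_density ε hu hv).aestronglyMeasurable]
  refine ⟨ae_of_all _ fun y => ?_, ?_⟩
  · refine Integrable.of_integral_ne_zero ?_
    rw [h y]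
    exact one_ne_zero
  · simp only [Real.norm_of_nonneg (density_pos _ _ _ _).le, h _]
    exact integrable_const 1

lemma HasUnitMarginal.integral_eq [SFinite μ] [IsProbabilityMeasure ν]
    (h : HasUnitMarginal ε μ u v) (hu : Measurable u) (hv : Measurable v) :
    ∫ z, density ε u v z ∂(μ.prod ν) = 1 := by
  rw [integral_prod_symm _ (h.integrable hu hv)]
  simp [h _]

lemma HasUnitMarginal.dualValue_eq [SFinite μ] [IsProbabilityMeasure ν]
    (h : HasUnitMarginal ε μ u v) (hu : Measurable u) (hv : Measurable v) :
    dualValue ε μ ν u v = ∫ x, u x ∂μ + ∫ y, v y ∂ν := by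
  rw [dualValue, h.integral_eq hu hv]
  ring

lemma integral_density_left (y : Rd d) :
    ∫ x, density ε u v (x, y) ∂μ = Real.exp (v y) * ∫ x, Real.exp (u x - scaledCost ε x y) ∂μ := by
  rw [← integral_const_mul]
  congr 1 with x
  rw [density, ← Real.exp_add]
  ring_nf

variable {K L η M : ℝ} [IsProbabilityMeasure μ] [IsProbabilityMeasure ν]

lemma hasUnitMarginal_softTransform (hε : 0 < ε) (hη : 0 < η) (hμ : HasExpSqMoment η M μ)
    (hu : Tame ε K u) : HasUnitMarginal ε μ u (softTransform ε μ u) := fun y => by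
  rw [integral_density_left, ← hu.exp_neg_softTransform hε hη hμ, ← Real.exp_add]
  simp

/-- `c(x, y)` integrated against two measures with square-exponential moments. -/
noncomputable def costBound (ε η M : ℝ) : ℝ := (1 / ε + 4 * (1 + M / η) / ε) * (1 + M / η)

lemma integral_softTransform_le (hε : 0 < ε) (hη : 0 < η) (hμ : HasExpSqMoment η M μ)
    (hν : HasExpSqMoment η M ν) (hu : Tame ε K u) :
    ∫ x, u x ∂μ + ∫ y, softTransform ε μ u y ∂ν ≤ costBound ε η M := by
  obtain ⟨L, hL⟩ := hu.exists_tame_softTransform hε hη hμ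
  have hM := hμ.one_le hη
  have hB : 0 ≤ 1 / ε + 4 * (1 + M / η) / ε := by positivity
  have hbd : ∀ y, |(1 / ε + 4 * (1 + M / η) / ε) * (1 + ‖y‖ ^ 2)| ≤
      (1 / ε + 4 * (1 + M / η) / ε) * (1 + ‖y‖ ^ 2) :=
    fun y : Rd d => (abs_of_nonneg (by positivity)).le
  have hi : Integrable (fun y : Rd d => (1 / ε + 4 * (1 + M / η) / ε) * (1 + ‖y‖ ^ 2)) ν :=
    hν.integrable_of_abs_le hη (by fun_prop) hbd
  have h1 : ∫ y, softTransform ε μ u y ∂ν ≤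
      ∫ y, ((1 / ε + 4 * (1 + M / η) / ε) * (1 + ‖y‖ ^ 2) - ∫ x, u x ∂μ) ∂ν := by
    refine integral_mono (hL.integrable hε hη hν) (hi.sub (integrable_const _)) fun y => ?_
    refine (softTransform_le_integral hε hη hμ hu y).trans ?_
    have h := integral_scaledCost_le hε hη hμ y
    have h3 : ‖y‖ ≤ 1 + ‖y‖ ^ 2 := by nlinarith [sq_nonneg (‖y‖ - 1)]
    have h4 : 0 ≤ 2 * (1 + M / η) / ε := by positivity
    have h5 : 0 ≤ 1 / ε := by positivity
    have e1 : 4 * (1 + M / η) / ε = 2 * (2 * (1 + M / η) / ε) := by ring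
    have e2 : ‖y‖ ^ 2 / ε = 1 / ε * ‖y‖ ^ 2 := by ring
    rw [e2] at h
    rw [e1]
    nlinarith [mul_le_mul_of_nonneg_left h3 h4, mul_nonneg h4 (sq_nonneg ‖y‖)]
  rw [integral_sub hi (integrable_const _)] at h1
  have h2 := (le_abs_self _).trans (hν.abs_integral_le hη hB hbd)
  unfold costBound
  simp only [integral_const, probReal_univ, smul_eq_mul, one_mul] at h1
  linarith

lemma integral_density_eq (hε : 0 < ε) (hη : 0 < η) (hμ : HasExpSqMoment η M μ)
    (hu : Tame ε K u) (hp : Integrable (density ε u v) (μ.prod ν)) :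
    Integrable (fun y => Real.exp (v y - softTransform ε μ u y)) ν ∧
    ∫ z, density ε u v z ∂(μ.prod ν) = ∫ y, Real.exp (v y - softTransform ε μ u y) ∂ν := by
  have h : ∀ y, ∫ x, density ε u v (x, y) ∂μ = Real.exp (v y - softTransform ε μ u y) :=
    fun y => by
      rw [integral_density_left, ← hu.exp_neg_softTransform hε hη hμ, ← Real.exp_add,
        sub_eq_add_neg]
  refine ⟨hp.integral_prod_right.congr (ae_of_all _ h), ?_⟩
  rw [integral_prod_symm _ hp]
  simp [h]

/-- For fixed u, integrate 1 + t ≤ exp t at t = v - T u: the soft transform is the best partner of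
u. -/
lemma dualValue_le_softTransform (hε : 0 < ε) (hη : 0 < η) (hμ : HasExpSqMoment η M μ)
    (hν : HasExpSqMoment η M ν) (hu : Tame ε K u) (hv : Tame ε L v)
    (hp : Integrable (density ε u v) (μ.prod ν)) :
    dualValue ε μ ν u v ≤ ∫ x, u x ∂μ + ∫ y, softTransform ε μ u y ∂ν := by
  obtain ⟨L', hL'⟩ := hu.exists_tame_softTransform hε hη hμ
  obtain ⟨hi, he⟩ := integral_density_eq hε hη hμ hu hp
  have hv' := hv.integrable hε hη hν
  have hw := hL'.integrable hε hη hν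
  have hvw : Integrable (fun y => v y - softTransform ε μ u y) ν := hv'.sub hw
  have : ∫ y, (v y - softTransform ε μ u y + 1) ∂ν ≤
      ∫ y, Real.exp (v y - softTransform ε μ u y) ∂ν :=
    integral_mono (hvw.add (integrable_const 1)) hi fun y => Real.add_one_le_exp _
  rw [integral_add hvw (integrable_const 1), integral_sub hv' hw] at this
  simp only [integral_const, probReal_univ, smul_eq_mul, one_mul] at this
  rw [dualValue, he]
  linarith

/-- This is the equality case of 1 + t ≤ exp t. -/
lemma ae_eq_softTransform (hε : 0 < ε) (hη : 0 < η) (hμ : HasExpSqMoment η M μ)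
    (hν : HasExpSqMoment η M ν) (hu : Tame ε K u) (hv : Tame ε L v)
    (hp : Integrable (density ε u v) (μ.prod ν))
    (h : ∫ x, u x ∂μ + ∫ y, softTransform ε μ u y ∂ν ≤ dualValue ε μ ν u v) :
    v =ᵐ[ν] softTransform ε μ u := by
  obtain ⟨L', hL'⟩ := hu.exists_tame_softTransform hε hη hμ
  obtain ⟨hi, he⟩ := integral_density_eq hε hη hμ hu hp
  have hv' := hv.integrable hε hη hν
  have hw := hL'.integrable hε hη hν
  have hvw : Integrable (fun y => v y - softTransform ε μ u y) ν := hv'.sub hw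
  have hi2 : Integrable (fun y => v y - softTransform ε μ u y + 1) ν :=
    hvw.add (integrable_const 1)
  have hnn : 0 ≤ fun y => Real.exp (v y - softTransform ε μ u y) -
      (v y - softTransform ε μ u y + 1) := fun y => sub_nonneg.2 (Real.add_one_le_exp _)
  have h0 : ∫ y, (Real.exp (v y - softTransform ε μ u y) -
      (v y - softTransform ε μ u y + 1)) ∂ν = 0 := by
    refine le_antisymm ?_ (integral_nonneg hnn)
    rw [integral_sub hi hi2, integral_add hvw (integrable_const 1), integral_sub hv' hw]
    simp only [integral_const, probReal_univ, smul_eq_mul, one_mul]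
    rw [dualValue, he] at h
    linarith
  filter_upwards [(integral_eq_zero_iff_of_nonneg hnn (hi.sub hi2)).1 h0] with y hy
  by_contra hne
  have := Real.add_one_lt_exp (sub_ne_zero.2 hne)
  simp only [Pi.zero_apply] at hy
  linarith

lemma dualValue_le_costBound (hε : 0 < ε) (hη : 0 < η) (hμ : HasExpSqMoment η M μ)
    (hν : HasExpSqMoment η M ν) (hu : Tame ε K u) (hv : Tame ε L v)
    (hp : Integrable (density ε u v) (μ.prod ν)) :
    dualValue ε μ ν u v ≤ costBound ε η M :=
  (dualValue_le_softTransform hε hη hμ hν hu hv hp).trans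
    (integral_softTransform_le hε hη hμ hν hu)

end Marginal

/-! ### Hellinger distance of Gibbs densities as concavity defect -/

section Hellinger

variable {ε : ℝ} {μ ν : Measure (Rd d)} {u u' v v' : Rd d → ℝ}

lemma density_sqrt_sub_sq (z : Rd d × Rd d) :
    (Real.sqrt (density ε u v z) - Real.sqrt (density ε u' v' z)) ^ 2 =
      density ε u v z + density ε u' v' z -
        2 * density ε (fun x => (u x + u' x) / 2) (fun y => (v y + v' y) / 2) z := by
  have h : Real.sqrt (density ε u v z) * Real.sqrt (density ε u' v' z) =
      density ε (fun x => (u x + u' x) / 2) (fun y => (v y + v' y) / 2) z := by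
    simp only [density, ← Real.exp_half, ← Real.exp_add]
    ring_nf
  rw [sub_sq, Real.sq_sqrt (density_pos _ _ _ _).le, Real.sq_sqrt (density_pos _ _ _ _).le,
    mul_assoc, h]
  ring

lemma integrable_density_midpoint (hu : Measurable u) (hu' : Measurable u') (hv : Measurable v)
    (hv' : Measurable v') (hp : Integrable (density ε u v) (μ.prod ν))
    (hp' : Integrable (density ε u' v') (μ.prod ν)) :
    Integrable (density ε (fun x => (u x + u' x) / 2) (fun y => (v y + v' y) / 2))
      (μ.prod ν) := by
  refine (hp.add hp').mono' (measurable_density ε ((hu.add hu').div_const 2)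
    ((hv.add hv').div_const 2)).aestronglyMeasurable (ae_of_all _ fun z => ?_)
  rw [Real.norm_of_nonneg (density_pos _ _ _ _).le, Pi.add_apply]
  have := density_sqrt_sub_sq (ε := ε) (u := u) (u' := u') (v := v) (v' := v') z
  nlinarith [sq_nonneg (Real.sqrt (density ε u v z) - Real.sqrt (density ε u' v' z)),
    density_pos ε (fun x => (u x + u' x) / 2) (fun y => (v y + v' y) / 2) z]

/-- The geometric mean of two Gibbs densities is the density of the midpoint, and the linear terms
of the dual objective cancel there. Two pairs within δ of the supremum are therefore at distance at
most √(2δ). -/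
lemma eLpNorm_sqrt_density_sub (hp : Integrable (density ε u v) (μ.prod ν))
    (hp' : Integrable (density ε u' v') (μ.prod ν))
    (hu : Measurable u) (hu' : Measurable u') (hv : Measurable v) (hv' : Measurable v')
    (iu : Integrable u μ) (iu' : Integrable u' μ) (iv : Integrable v ν) (iv' : Integrable v' ν) :
    eLpNorm ((fun z => Real.sqrt (density ε u v z)) - fun z => Real.sqrt (density ε u' v' z)) 2
      (μ.prod ν) =
    ENNReal.ofReal (Real.sqrt (2 * dualValue ε μ ν (fun x => (u x + u' x) / 2)
      (fun y => (v y + v' y) / 2) - dualValue ε μ ν u v - dualValue ε μ ν u' v')) := by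
  have hm := integrable_density_midpoint hu hu' hv hv' hp hp'
  have hint : ∫ z, (Real.sqrt (density ε u v z) - Real.sqrt (density ε u' v' z)) ^ 2 ∂(μ.prod ν)
      = 2 * dualValue ε μ ν (fun x => (u x + u' x) / 2)
      (fun y => (v y + v' y) / 2) - dualValue ε μ ν u v - dualValue ε μ ν u' v' := by
    simp only [density_sqrt_sub_sq]
    have hpp : Integrable (fun z => density ε u v z + density ε u' v' z) (μ.prod ν) := hp.add hp'
    rw [integral_sub hpp (hm.const_mul 2), integral_add hp hp', integral_const_mul]
    simp only [dualValue]
    rw [integral_div, integral_div, integral_add iu iu', integral_add iv iv']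
    ring
  have hms : AEStronglyMeasurable ((fun z => Real.sqrt (density ε u v z)) -
      fun z => Real.sqrt (density ε u' v' z)) (μ.prod ν) :=
    ((measurable_density ε hu hv).sqrt.sub (measurable_density ε hu' hv').sqrt).aestronglyMeasurable
  have hmem : MemLp ((fun z => Real.sqrt (density ε u v z)) -
      fun z => Real.sqrt (density ε u' v' z)) 2 (μ.prod ν) := by
    rw [memLp_two_iff_integrable_sq hms]
    refine ((hp.add hp').sub (hm.const_mul 2)).congr (ae_of_all _ fun z => ?_)
    simp only [Pi.sub_apply, density_sqrt_sub_sq, Pi.add_apply]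
  rw [hmem.eLpNorm_eq_integral_rpow_norm (by norm_num) (by norm_num), ← hint, Real.sqrt_eq_rpow]
  simp

lemma tendsto_add_of_tendsto_sqrt_density {ι : Type*} {l : Filter ι} [l.NeBot] {K : ℝ}
    {U V : ι → Rd d → ℝ} (hU : ∀ n, Tame ε K (U n)) (hV : ∀ n, Tame ε K (V n)) {z : Rd d × Rd d}
    {a : ℝ} (h : Tendsto (fun n => Real.sqrt (density ε (U n) (V n) z)) l (𝓝 a)) :
    Tendsto (fun n => U n z.1 + V n z.2) l
      (𝓝 (2 * Real.log a + scaledCost ε z.1 z.2)) := by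
  have hlow : ∀ n, Real.exp ((-(K * (1 + ‖z.1‖ ^ 2)) + -(K * (1 + ‖z.2‖ ^ 2)) -
      scaledCost ε z.1 z.2) / 2) ≤ Real.sqrt (density ε (U n) (V n) z) := fun n => by
    rw [density, ← Real.exp_half]
    gcongr
    · exact (hU n).lower _
    · exact (hV n).lower _
  -- The lower tame bounds keep the limit away from 0, so the logarithm can be taken.
  have ha : 0 < a := (Real.exp_pos _).trans_le (ge_of_tendsto' h hlow)
  have h2 := (((Real.continuousAt_log ha.ne').tendsto.comp h).const_mul 2).add_const
    (scaledCost ε z.1 z.2)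
  refine h2.congr fun n => ?_
  simp only [Function.comp, density, ← Real.exp_half, Real.log_exp]
  ring

end Hellinger

end

/-! ### Limits of tame potentials and uniform bounds -/

section

variable {d : ℕ} {ε η M K : ℝ} {μ ν : Measure (Rd d)}

lemma Tame.abs_integral_le [IsProbabilityMeasure μ] (hε : 0 < ε) (hη : 0 < η)
    (hμ : HasExpSqMoment η M μ) {u : Rd d → ℝ} (hu : Tame ε K u) :
    |∫ x, u x ∂μ| ≤ (2 * K + 1 / ε) * (1 + M / η) := by
  have := hu.nonneg
  exact hμ.abs_integral_le hη (by positivity) (hu.abs_le hε)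

lemma Tame.softTransform [IsProbabilityMeasure μ] (hε : 0 < ε) (hη : 0 < η)
    (hμ : HasExpSqMoment η M μ) {u : Rd d → ℝ} (hu : Tame ε K u) :
    Tame ε (transformBound ε η M ((2 * K + 1 / ε) * (1 + M / η))) (softTransform ε μ u) := by
  have hK := hu.nonneg
  have hM := hμ.one_le hη
  have hle : K ≤ (2 * K + 1 / ε) * (1 + M / η) := by
    have h1 : 0 ≤ 1 / ε := by positivity
    have h2 : 0 ≤ M / η := by positivity
    nlinarith [mul_nonneg h1 h2, mul_nonneg hK h2]
  refine tame_softTransform hε hη hμ hu (by positivity) (fun x => (hu.upper x).trans ?_)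
    (_root_.abs_le.1 (hu.abs_integral_le hε hη hμ)).1
  gcongr

lemma Tame.of_tendsto {U : ℕ → Rd d → ℝ} {w : Rd d → ℝ} (hU : ∀ n, Tame ε K (U n))
    (h : ∀ x, Tendsto (fun n => U n x) atTop (𝓝 (w x))) : Tame ε K w :=
  ⟨measurable_of_tendsto_metrizable (fun n => (hU n).measurable) (tendsto_pi_nhds.2 h),
    fun x => ge_of_tendsto' (h x) fun n => (hU n).lower x,
    fun x => le_of_tendsto' (h x) fun n => (hU n).upper x⟩

/-- Almost everywhere convergence becomes convergence at every point. -/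
lemma tendsto_softTransform [IsProbabilityMeasure μ] (hε : 0 < ε) (hη : 0 < η)
    (hμ : HasExpSqMoment η M μ) {U : ℕ → Rd d → ℝ} {w : Rd d → ℝ} (hU : ∀ n, Tame ε K (U n))
    (h : ∀ᵐ x ∂μ, Tendsto (fun n => U n x) atTop (𝓝 (w x))) (y : Rd d) :
    Tendsto (fun n => softTransform ε μ (U n) y) atTop (𝓝 (softTransform ε μ w y)) := by
  have hE := tendsto_integral_exp_sub_scaledCost hε hη hμ hU h y
  refine (Tendsto.log hE (ne_of_gt ?_)).neg
  -- The upper tame bound on the transforms bounds the integrals below, so their limit is positive.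
  refine (Real.exp_pos (-(‖y‖ ^ 2 / ε +
    transformBound ε η M ((2 * K + 1 / ε) * (1 + M / η)) * (1 + ‖y‖)))).trans_le
    (ge_of_tendsto' hE fun n => ?_)
  rw [← (hU n).exp_neg_softTransform hε hη hμ]
  exact Real.exp_le_exp.2 (neg_le_neg (((hU n).softTransform hε hη hμ).upper y))

lemma tendsto_integral_of_tame [IsFiniteMeasure μ] (hε : 0 < ε) (hη : 0 < η)
    (hμ : HasExpSqMoment η M μ) {U : ℕ → Rd d → ℝ} {w : Rd d → ℝ} (hU : ∀ n, Tame ε K (U n))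
    (h : ∀ᵐ x ∂μ, Tendsto (fun n => U n x) atTop (𝓝 (w x))) :
    Tendsto (fun n => ∫ x, U n x ∂μ) atTop (𝓝 (∫ x, w x ∂μ)) := by
  refine tendsto_integral_of_dominated_convergence
    (fun x => (2 * K + 1 / ε) * (1 + ‖x‖ ^ 2))
    (fun n => (hU n).measurable.aestronglyMeasurable)
    (((integrable_const 1).add (hμ.integrable_sq hη)).const_mul _)
    (fun n => ae_of_all _ fun x => (hU n).abs_le hε x) h

lemma tame_le_of_cost_le {a B C : ℝ} (hC : 0 ≤ C) {f : Rd d → ℝ}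
    (h : ∀ y, f y ≤ ‖y‖ ^ 2 / ε + B * (1 + ‖y‖) + a) (ha : a ≤ C) (y : Rd d) :
    f y ≤ ‖y‖ ^ 2 / ε + (B + C) * (1 + ‖y‖) := by
  nlinarith [h y, norm_nonneg y, mul_nonneg hC (norm_nonneg y)]

/-- Two steps of the Sinkhorn iteration followed by a normalisation improve the dual value and give
bounds that depend on the moments of the measures only. -/
lemma exists_uniform_improvement (hε : 0 < ε) (hη : 0 < η) (M : ℝ) : ∃ K : ℝ,
    ∀ (μ ν : Measure (Rd d)) [IsProbabilityMeasure μ] [IsProbabilityMeasure ν],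
    HasExpSqMoment η M μ → HasExpSqMoment η M ν →
    ∀ (u v : Rd d → ℝ) (L L' : ℝ), Tame ε L u → Tame ε L' v →
    Integrable (density ε u v) (μ.prod ν) → -1 ≤ dualValue ε μ ν u v →
    ∃ u', Tame ε K u' ∧ Tame ε K (softTransform ε μ u') ∧
      dualValue ε μ ν u v ≤ dualValue ε μ ν u' (softTransform ε μ u') := by
  -- The first summand comes from ∫ c dμ, the second bounds a - ∫ u dμ below; together they control
  -- v₁ + a from above.
  set K₁ := 2 * (1 + M / η) / ε + (costBound ε η M + 1) with hK₁
  set K₂ := transformBound ε η M K₁ with hK₂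
  refine ⟨max K₂ (transformBound ε η M ((2 * K₂ + 1 / ε) * (1 + M / η))), ?_⟩
  intro μ ν _ _ hμ hν u v L L' hu hv hp hD
  have hM := hμ.one_le hη
  have hB : 0 ≤ 2 * (1 + M / η) / ε := by positivity
  have hC : 0 ≤ costBound ε η M := by unfold costBound; positivity
  set v₁ := softTransform ε μ u with hv₁
  have tv₁ : Tame ε _ v₁ := hu.softTransform hε hη hμ
  set u₁ := softTransform ε ν v₁ with hu₁
  have tu₁ : Tame ε _ u₁ := tv₁.softTransform hε hη hν
  -- Moving the constant a from u₁ to v₁ preserves the dual value and centres u₁.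
  set a := ∫ x, u₁ x ∂μ with ha
  have hiv₁ := tv₁.integrable hε hη hν
  have hiu₁ := tu₁.integrable hε hη hμ
  have m₁ : HasUnitMarginal ε μ u v₁ := hasUnitMarginal_softTransform hε hη hμ hu
  have m₂ : HasUnitMarginal ε ν v₁ u₁ := hasUnitMarginal_softTransform hε hη hν tv₁
  have d₁ : dualValue ε μ ν u v ≤ ∫ x, u x ∂μ + ∫ y, v₁ y ∂ν :=
    dualValue_le_softTransform hε hη hμ hν hu hv hp
  have d₂ : ∫ x, u x ∂μ + ∫ y, v₁ y ∂ν ≤ ∫ y, v₁ y ∂ν + a := by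
    rw [← m₁.dualValue_eq (ν := ν) hu.measurable tv₁.measurable, ← dualValue_swap]
    exact dualValue_le_softTransform hε hη hν hμ tv₁ hu
      (integrable_density_swap (m₁.integrable hu.measurable tv₁.measurable))
  have d₃ : ∫ y, v₁ y ∂ν + a ≤ costBound ε η M := integral_softTransform_le hε hη hν hμ tv₁
  have p₁ : Integrable (density ε u₁ v₁) (μ.prod ν) :=
    integrable_density_swap (m₂.integrable tv₁.measurable tu₁.measurable)
  have e₂ : dualValue ε μ ν u₁ v₁ = ∫ y, v₁ y ∂ν + a := by
    rw [← dualValue_swap, m₂.dualValue_eq tv₁.measurable tu₁.measurable]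
  have tv₂ := tv₁.add_const a
  have hint : ∫ y, (v₁ y + a) ∂ν = ∫ y, v₁ y ∂ν + a := by
    rw [integral_add hiv₁ (integrable_const _)]; simp
  have hu₂ : softTransform ε ν (fun y => v₁ y + a) = fun x => u₁ x - a :=
    tv₁.softTransform_add_const hε hη hν a
  have tu₂ : Tame ε K₂ (fun x => u₁ x - a) := by
    rw [← hu₂]
    refine tame_softTransform hε hη hν tv₂ (by positivity) ?_ ?_
    -- Here a - ∫ u dμ is (∫ v₁ dν + a) - (∫ u dμ + ∫ v₁ dν): at most `costBound` minus a quantity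
    -- that is at least -1.
    · refine tame_le_of_cost_le (by positivity) (a := a - ∫ x, u x ∂μ) (fun y => ?_) ?_
      · have := softTransform_le_integral hε hη hμ hu y
        have := integral_scaledCost_le hε hη hμ y
        linarith
      · linarith
    · rw [hint]
      linarith [show 0 ≤ K₁ by positivity]
  have hT : softTransform ε μ (fun x => u₁ x - a) = fun y => softTransform ε μ u₁ y + a := by
    have := tu₁.softTransform_add_const hε hη hμ (-a)
    simpa [sub_eq_add_neg] using this
  refine ⟨fun x => u₁ x - a, tu₂.mono (le_max_left _ _),
    (tu₂.softTransform hε hη hμ).mono (le_max_right _ _), ?_⟩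
  rw [(hasUnitMarginal_softTransform hε hη hμ tu₂).dualValue_eq tu₂.measurable
    (tu₂.softTransform hε hη hμ).measurable]
  rw [hT, integral_sub hiu₁ (integrable_const _),
    integral_add ((tu₁.softTransform hε hη hμ).integrable hε hη hν) (integrable_const _)]
  have d₄ := dualValue_le_softTransform hε hη hμ hν tu₁ tv₁ p₁
  simp only [integral_const, probReal_univ, smul_eq_mul, one_mul]
  linarith

end

/-! ### Existence of Schrödinger potentials -/

section

variable {d : ℕ} {ε η M K : ℝ} {μ ν : Measure (Rd d)}

/-- A pair of potentials that are soft transforms of each other. -/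
structure IsPotentialPair (ε : ℝ) (μ ν : Measure (Rd d)) (u v : Rd d → ℝ) : Prop where
  left : u = softTransform ε ν v
  right : v = softTransform ε μ u

/-- A sequence of tame potentials converges along a subsequence at a point of almost sure good
behaviour. -/
lemma exists_subseq_tendsto_of_ae_prod [IsProbabilityMeasure μ] [SFinite ν]
    {U : ℕ → Rd d → ℝ} (hU : ∀ n, Tame ε K (U n)) {P : Rd d × Rd d → Prop}
    (h : ∀ᵐ z ∂(μ.prod ν), P z) :
    ∃ φ : ℕ → ℕ, StrictMono φ ∧ ∃ (x₀ : Rd d) (a : ℝ),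
      Tendsto (fun n => U (φ n) x₀) atTop (𝓝 a) ∧ ∀ᵐ y ∂ν, P (x₀, y) := by
  obtain ⟨x₀, hx₀⟩ := (Measure.ae_ae_of_ae_prod h).exists
  obtain ⟨a, -, φ, hφ, ha⟩ := tendsto_subseq_of_bounded
    (Metric.isBounded_Icc (-(K * (1 + ‖x₀‖ ^ 2))) (‖x₀‖ ^ 2 / ε + K * (1 + ‖x₀‖)))
    (x := fun n => U n x₀) (fun n => ⟨(hU n).lower x₀, (hU n).upper x₀⟩)
  exact ⟨φ, hφ, x₀, a, ha, hx₀⟩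

lemma exists_maximizing_sequence (hε : 0 < ε) (hη : 0 < η) (M : ℝ) : ∃ K : ℝ,
    ∀ (μ ν : Measure (Rd d)) [IsProbabilityMeasure μ] [IsProbabilityMeasure ν],
    HasExpSqMoment η M μ → HasExpSqMoment η M ν → ∃ (S : ℝ) (U : ℕ → Rd d → ℝ),
      (∀ n, Tame ε K (U n)) ∧ (∀ n, Tame ε K (softTransform ε μ (U n))) ∧
      (∀ n, S - (1 / 4) ^ n ≤ dualValue ε μ ν (U n) (softTransform ε μ (U n))) ∧
      ∀ (u v : Rd d → ℝ) (L L' : ℝ), Tame ε L u → Tame ε L' v →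
        Integrable (density ε u v) (μ.prod ν) → dualValue ε μ ν u v ≤ S := by
  obtain ⟨K, hK⟩ := exists_uniform_improvement (d := d) hε hη M
  refine ⟨K, fun μ ν _ _ hμ hν => ?_⟩
  set A : Set ℝ := {r | ∃ (u v : Rd d → ℝ) (L L' : ℝ), Tame ε L u ∧ Tame ε L' v ∧
    Integrable (density ε u v) (μ.prod ν) ∧ r = dualValue ε μ ν u v} with hA
  have hbdd : BddAbove A := by
    refine ⟨costBound ε η M, ?_⟩
    rintro _ ⟨u, v, L, L', hu, hv, hp, rfl⟩
    exact dualValue_le_costBound hε hη hμ hν hu hv hp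
  -- The pair (0, 0) is a competitor. Errors (1/4)^n ≤ 1 then leave values at least -1, the
  -- threshold of `exists_uniform_improvement`.
  have h0 : (0 : ℝ) ≤ sSup A := by
    have hp : Integrable (density ε (fun _ : Rd d => (0 : ℝ)) fun _ => 0) (μ.prod ν) := by
      refine (integrable_const (1 : ℝ)).mono'
        (measurable_density ε measurable_const measurable_const).aestronglyMeasurable
        (ae_of_all _ fun z => ?_)
      rw [Real.norm_of_nonneg (density_pos _ _ _ _).le, density]
      refine Real.exp_le_one_iff.2 ?_
      linarith [scaledCost_nonneg hε z.1 z.2]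
    refine le_trans ?_ (le_csSup hbdd ⟨_, _, _, _, tame_zero hε, tame_zero hε, hp, rfl⟩)
    have : ∫ z, density ε (fun _ : Rd d => (0 : ℝ)) (fun _ => 0) z ∂(μ.prod ν) ≤
        ∫ _, (1 : ℝ) ∂(μ.prod ν) := by
      refine integral_mono hp (integrable_const _) fun z => ?_
      refine Real.exp_le_one_iff.2 ?_
      linarith [scaledCost_nonneg hε z.1 z.2]
    simp only [integral_const, probReal_univ, smul_eq_mul, mul_one] at this
    simp only [dualValue, integral_zero]
    linarith
  have hne : A.Nonempty := by
    by_contra h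
    have tz := tame_zero (d := d) hε
    obtain ⟨L, hL⟩ := tz.exists_tame_softTransform hε hη hμ
    exact h ⟨_, _, _, _, _, tz, hL, (hasUnitMarginal_softTransform hε hη hμ tz).integrable
      tz.measurable hL.measurable, rfl⟩
  have hseq : ∀ n : ℕ, ∃ u, Tame ε K u ∧ Tame ε K (softTransform ε μ u) ∧
      sSup A - (1 / 4) ^ n ≤ dualValue ε μ ν u (softTransform ε μ u) := by
    intro n
    have hpos : (0 : ℝ) < (1 / 4) ^ n := by positivity
    obtain ⟨_, ⟨u, v, L, L', hu, hv, hp, rfl⟩, hlt⟩ :=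
      exists_lt_of_lt_csSup hne (sub_lt_self (sSup A) hpos)
    have hle : ((1 : ℝ) / 4) ^ n ≤ 1 := pow_le_one₀ (by norm_num) (by norm_num)
    obtain ⟨u', h1, h2, h3⟩ := hK μ ν hμ hν u v L L' hu hv hp (by linarith)
    exact ⟨u', h1, h2, hlt.le.trans h3⟩
  choose U h1 h2 h3 using hseq
  exact ⟨sSup A, U, h1, h2, h3, fun u v L L' hu hv hp =>
    le_csSup hbdd ⟨u, v, L, L', hu, hv, hp, rfl⟩⟩

/-- A sequence of tame potentials that maximizes the dual value fast enough has almost everywhere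
convergent sums. -/
lemma ae_exists_tendsto_add [IsProbabilityMeasure μ] [IsProbabilityMeasure ν]
    (hε : 0 < ε) (hη : 0 < η) (hμ : HasExpSqMoment η M μ) (hν : HasExpSqMoment η M ν) {S : ℝ}
    (hS : ∀ (u v : Rd d → ℝ) (L L' : ℝ), Tame ε L u → Tame ε L' v →
        Integrable (density ε u v) (μ.prod ν) → dualValue ε μ ν u v ≤ S)
    {U V : ℕ → Rd d → ℝ} (hU : ∀ n, Tame ε K (U n)) (hV : ∀ n, Tame ε K (V n))
    (hp : ∀ n, Integrable (density ε (U n) (V n)) (μ.prod ν))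
    (hD : ∀ n, S - (1 / 4) ^ n ≤ dualValue ε μ ν (U n) (V n)) :
    ∀ᵐ z ∂(μ.prod ν), ∃ l, Tendsto (fun n => U n z.1 + V n z.2) atTop (𝓝 l) := by
  -- The gap (1/4)^n turns under the square root into a summable rate, whence almost everywhere
  -- convergence of the whole sequence.
  have key := Lp.ae_tendsto_of_cauchy_eLpNorm (μ := μ.prod ν) (p := 2)
    (f := fun n z => Real.sqrt (density ε (U n) (V n) z))
    (B := fun n => ENNReal.ofReal (2 * (1 / 2) ^ n))
    (fun n => (measurable_density ε (hU n).measurable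
      (hV n).measurable).sqrt.aestronglyMeasurable) (by norm_num)
    (Summable.tsum_ofReal_ne_top ((summable_geometric_of_lt_one (by norm_num)
      (by norm_num)).mul_left 2)) ?_
  · filter_upwards [key] with z ⟨l, hl⟩
    exact ⟨_, tendsto_add_of_tendsto_sqrt_density hU hV hl⟩
  · intro N n m hn hm
    have hpow : ∀ k, N ≤ k → ((1 : ℝ) / 4) ^ k ≤ (1 / 4) ^ N := fun k hk =>
      pow_le_pow_of_le_one (by norm_num) (by norm_num) hk
    change eLpNorm ((fun z => Real.sqrt (density ε (U n) (V n) z)) -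
      fun z => Real.sqrt (density ε (U m) (V m) z)) 2 (μ.prod ν) < _
    rw [eLpNorm_sqrt_density_sub (hp n) (hp m) (hU n).measurable (hU m).measurable
      (hV n).measurable (hV m).measurable ((hU n).integrable hε hη hμ)
      ((hU m).integrable hε hη hμ) ((hV n).integrable hε hη hν) ((hV m).integrable hε hη hν)]
    rw [ENNReal.ofReal_lt_ofReal_iff (by positivity), Real.sqrt_lt' (by positivity)]
    have hmid := hS _ _ _ _ ((hU n).convex_comb (hU m)) ((hV n).convex_comb (hV m))
      (integrable_density_midpoint (hU n).measurable (hU m).measurable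
      (hV n).measurable (hV m).measurable (hp n) (hp m))
    have h4 : ((2 : ℝ) * (1 / 2) ^ N) ^ 2 = 4 * (1 / 4) ^ N := by
      rw [mul_pow, ← pow_mul, mul_comm N, pow_mul]; norm_num
    rw [h4]
    have := hD n
    have := hD m
    have := hpow n hn
    have := hpow m hm
    have : (0 : ℝ) < (1 / 4) ^ N := by positivity
    linarith

/-- Existence of Schrödinger potentials, with bounds that depend on the moments only. -/
theorem exists_potentialPair (hε : 0 < ε) (hη : 0 < η) (M : ℝ) : ∃ K : ℝ,
    ∀ (μ ν : Measure (Rd d)) [IsProbabilityMeasure μ] [IsProbabilityMeasure ν],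
    HasExpSqMoment η M μ → HasExpSqMoment η M ν →
    ∃ u v, Tame ε K u ∧ Tame ε K v ∧ IsPotentialPair ε μ ν u v := by
  obtain ⟨K, hK⟩ := exists_maximizing_sequence (d := d) hε hη M
  set B : ℝ → ℝ := fun K => transformBound ε η M ((2 * K + 1 / ε) * (1 + M / η)) with hB
  refine ⟨max (B (B K)) (B (B (B K))), fun μ ν _ _ hμ hν => ?_⟩
  obtain ⟨S, U, hU, hV, hD, hS⟩ := hK μ ν hμ hν
  have hmU : ∀ n, HasUnitMarginal ε μ (U n) (softTransform ε μ (U n)) :=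
    fun n => hasUnitMarginal_softTransform hε hη hμ (hU n)
  have hp : ∀ n, Integrable (density ε (U n) (softTransform ε μ (U n))) (μ.prod ν) :=
    fun n => (hmU n).integrable (hU n).measurable (hV n).measurable
  obtain ⟨φ, hφ, x₀, a, ha, hlim⟩ := exists_subseq_tendsto_of_ae_prod hU
    (ae_exists_tendsto_add hε hη hμ hν hS hU hV hp hD)
  set V : ℕ → Rd d → ℝ := fun n => softTransform ε μ (U (φ n)) with hVdef
  -- Arbitrary values where no limit exists are harmless: that set is ν-null and `w` is used only
  -- through its soft transform.
  set w : Rd d → ℝ := fun y => limUnder atTop (fun n => V n y) with hw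
  have hVw : ∀ᵐ y ∂ν, Tendsto (fun n => V n y) atTop (𝓝 (w y)) := by
    filter_upwards [hlim] with y ⟨l, hl⟩
    refine tendsto_nhds_limUnder ⟨l - a, ((hl.comp hφ.tendsto_atTop).sub ha).congr fun n => ?_⟩
    simp [hVdef]
  have tV : ∀ n, Tame ε K (V n) := fun n => hV (φ n)
  set U₁ : ℕ → Rd d → ℝ := fun n => softTransform ε ν (V n)
  set u₁ := softTransform ε ν w
  have tU₁ : ∀ n, Tame ε (B K) (U₁ n) := fun n => (tV n).softTransform hε hη hν
  have hU₁ : ∀ x, Tendsto (fun n => U₁ n x) atTop (𝓝 (u₁ x)) :=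
    fun x => tendsto_softTransform hε hη hν tV hVw x
  have tu₁ : Tame ε (B K) u₁ := Tame.of_tendsto tU₁ hU₁
  set V₁ : ℕ → Rd d → ℝ := fun n => softTransform ε μ (U₁ n)
  set v₁ := softTransform ε μ u₁
  have tV₁ : ∀ n, Tame ε (B (B K)) (V₁ n) := fun n => (tU₁ n).softTransform hε hη hμ
  have tv₁ : Tame ε (B (B K)) v₁ := tu₁.softTransform hε hη hμ
  have hV₁ : ∀ x, Tendsto (fun n => V₁ n x) atTop (𝓝 (v₁ x)) :=
    fun x => tendsto_softTransform hε hη hμ tU₁ (ae_of_all _ hU₁) x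
  have hval : ∀ n, S - (1 / 4) ^ (φ n) ≤ ∫ x, U₁ n x ∂μ + ∫ y, V₁ n y ∂ν := by
    intro n
    refine (hD (φ n)).trans ?_
    have m₂ : HasUnitMarginal ε ν (V n) (U₁ n) := hasUnitMarginal_softTransform hε hη hν (tV n)
    have h1 : dualValue ε μ ν (U (φ n)) (V n) ≤ ∫ y, V n y ∂ν + ∫ x, U₁ n x ∂μ := by
      rw [← dualValue_swap]
      exact dualValue_le_softTransform hε hη hν hμ (tV n) (hU _)
        (integrable_density_swap (hp (φ n)))
    refine h1.trans ?_
    rw [← m₂.dualValue_eq (ν := μ) (tV n).measurable (tU₁ n).measurable, dualValue_swap]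
    exact dualValue_le_softTransform hε hη hμ hν (tU₁ n) (tV n)
      (integrable_density_swap (m₂.integrable (tV n).measurable (tU₁ n).measurable))
  have hSle : S ≤ ∫ x, u₁ x ∂μ + ∫ y, v₁ y ∂ν := by
    have t1 := (tendsto_integral_of_tame hε hη hμ tU₁ (ae_of_all _ hU₁)).add
      (tendsto_integral_of_tame hε hη hν tV₁ (ae_of_all _ hV₁))
    have t2 : Tendsto (fun n => S - ((1 : ℝ) / 4) ^ (φ n)) atTop (𝓝 (S - 0)) :=
      ((tendsto_pow_atTop_nhds_zero_of_lt_one (by norm_num) (by norm_num)).comp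
        hφ.tendsto_atTop).const_sub S
    simpa using le_of_tendsto_of_tendsto' t2 t1 hval
  have m₁ : HasUnitMarginal ε μ u₁ v₁ := hasUnitMarginal_softTransform hε hη hμ tu₁
  have p₁ := m₁.integrable (ν := ν) tu₁.measurable tv₁.measurable
  set u₂ := softTransform ε ν v₁
  have tu₂ : Tame ε (B (B (B K))) u₂ := tv₁.softTransform hε hη hν
  have m₂ : HasUnitMarginal ε ν v₁ u₂ := hasUnitMarginal_softTransform hε hη hν tv₁
  -- The best partner of v₁ gives at most S, which (u₁, v₁) already reaches.
  have hae : u₁ =ᵐ[μ] u₂ := by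
    refine ae_eq_softTransform hε hη hν hμ tv₁ tu₁ (integrable_density_swap p₁) ?_
    have := hS u₂ v₁ _ _ tu₂ tv₁ (integrable_density_swap
      (m₂.integrable tv₁.measurable tu₂.measurable))
    rw [← dualValue_swap, m₂.dualValue_eq tv₁.measurable tu₂.measurable] at this
    rw [dualValue_swap, m₁.dualValue_eq tu₁.measurable tv₁.measurable]
    exact this.trans hSle
  refine ⟨u₂, v₁, tu₂.mono (le_max_right _ _), tv₁.mono (le_max_left _ _), rfl, ?_⟩
  -- The transform against μ does not see the replacement of u₁ by the μ-a.e. equal u₂, so (u₂, v₁)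
  -- solves the system everywhere.
  funext y
  change softTransform ε μ u₁ y = softTransform ε μ u₂ y
  unfold softTransform
  congr 2
  refine integral_congr_ae ?_
  filter_upwards [hae] with x hx
  rw [hx]

end

/-! ### Duality between plans and potentials -/

section

variable {d : ℕ} {ε η M K L : ℝ}

/-- The Donsker–Varadhan lower bound for the Kullback–Leibler divergence. -/
lemma integral_sub_log_le_klDiv {X : Type*} [MeasurableSpace X] {π ρ : Measure X}
    [IsProbabilityMeasure π] [IsProbabilityMeasure ρ] {h : X → ℝ} (hπ : Integrable h π)
    (hR : Integrable (fun x => Real.exp (h x)) ρ) :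
    ENNReal.ofReal ((∫ x, h x ∂π) - Real.log (∫ x, Real.exp (h x) ∂ρ)) ≤ klDiv π ρ := by
  by_cases hfin : klDiv π ρ = ∞
  · simp [hfin]
  obtain ⟨hac, hllr⟩ := klDiv_ne_top_iff.1 hfin
  rw [klDiv_of_ac_of_integrable hac hllr]
  refine ENNReal.ofReal_le_ofReal ?_
  -- The inequality is the nonnegativity of the divergence of π from the tilted measure exp(h) ρ / ∫
  -- exp(h) dρ.
  have := isProbabilityMeasure_tilted hR
  have h1 := integral_llr_tilted_right hac hπ hR hllr
  have h2 := integral_llr_add_sub_measure_univ_nonneg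
    (hac.trans (absolutelyContinuous_tilted hR)) (integrable_llr_tilted_right hac hπ hllr hR)
  simp only [probReal_univ] at h2 ⊢
  linarith

/-- The log-likelihood ratio is h. The sign is recorded so that `ENNReal.ofReal` loses nothing when
cost and divergence are added. -/
lemma klDiv_withDensity_exp {X : Type*} [MeasurableSpace X] {R : Measure X}
    [IsProbabilityMeasure R] {h : X → ℝ} (hm : Measurable h)
    [IsProbabilityMeasure (R.withDensity fun x => ENNReal.ofReal (Real.exp (h x)))]
    (hi : Integrable h (R.withDensity fun x => ENNReal.ofReal (Real.exp (h x)))) :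
    0 ≤ ∫ x, h x ∂(R.withDensity fun x => ENNReal.ofReal (Real.exp (h x))) ∧
    klDiv (R.withDensity fun x => ENNReal.ofReal (Real.exp (h x))) R =
      ENNReal.ofReal (∫ x, h x ∂(R.withDensity fun x => ENNReal.ofReal (Real.exp (h x)))) := by
  set π := R.withDensity fun x => ENNReal.ofReal (Real.exp (h x)) with hπ
  have hac : π ≪ R := withDensity_absolutelyContinuous _ _
  have hllr : llr π R =ᵐ[π] h := by
    refine hac.ae_le ?_
    filter_upwards [Measure.rnDeriv_withDensity R
      (f := fun x => ENNReal.ofReal (Real.exp (h x))) (by fun_prop)] with x hx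
    rw [llr, hx, ENNReal.toReal_ofReal (Real.exp_nonneg _), Real.log_exp]
  have hnn := integral_llr_add_sub_measure_univ_nonneg hac (hi.congr hllr.symm)
  rw [klDiv_of_ac_of_integrable hac (hi.congr hllr.symm), integral_congr_ae hllr]
  rw [integral_congr_ae hllr] at hnn
  simpa using hnn

section Plans

variable {μ ν : ProbabilityMeasure (Rd d)} {π : Measure (Rd d × Rd d)}

lemma isProbabilityMeasure_of_mem_plans (hπ : π ∈ plans μ ν) : IsProbabilityMeasure π := by
  constructor
  rw [← Measure.fst_univ, hπ.1]
  exact measure_univ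

lemma integrable_fst_of_mem_plans (hπ : π ∈ plans μ ν) {f : Rd d → ℝ}
    (hf : Integrable f (μ : Measure (Rd d))) :
    Integrable (fun z : Rd d × Rd d => f z.1) π ∧
      ∫ z, f z.1 ∂π = ∫ x, f x ∂(μ : Measure (Rd d)) := by
  rw [← hπ.1, Measure.fst] at hf
  refine ⟨hf.comp_measurable measurable_fst, ?_⟩
  rw [← hπ.1, Measure.fst, integral_map measurable_fst.aemeasurable hf.aestronglyMeasurable]

lemma integrable_snd_of_mem_plans (hπ : π ∈ plans μ ν) {f : Rd d → ℝ}
    (hf : Integrable f (ν : Measure (Rd d))) :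
    Integrable (fun z : Rd d × Rd d => f z.2) π ∧
      ∫ z, f z.2 ∂π = ∫ x, f x ∂(ν : Measure (Rd d)) := by
  rw [← hπ.2, Measure.snd] at hf
  refine ⟨hf.comp_measurable measurable_snd, ?_⟩
  rw [← hπ.2, Measure.snd, integral_map measurable_snd.aemeasurable hf.aestronglyMeasurable]

lemma integrable_scaledCost_of_mem_plans (hε : 0 < ε) (hη : 0 < η)
    (hμ : HasExpSqMoment η M (μ : Measure (Rd d))) (hν : HasExpSqMoment η M (ν : Measure (Rd d)))
    (hπ : π ∈ plans μ ν) : Integrable (fun z => scaledCost ε z.1 z.2) π := by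
  refine ((((integrable_fst_of_mem_plans hπ (hμ.integrable_sq hη)).1.add
    (integrable_snd_of_mem_plans hπ (hν.integrable_sq hη)).1)).const_mul (2 / ε)).mono'
    (continuous_scaledCost ε).aestronglyMeasurable (ae_of_all _ fun z => ?_)
  rw [Real.norm_of_nonneg (scaledCost_nonneg hε _ _), Pi.add_apply, div_mul_eq_mul_div]
  refine (scaledCost_le hε _ _).trans ((div_le_div_iff_of_pos_right hε).2 ?_)
  nlinarith [sq_nonneg (‖z.1‖ - ‖z.2‖)]

lemma lintegral_cost_eq (hε : 0 < ε) (hi : Integrable (fun z => scaledCost ε z.1 z.2) π) :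
    ∫⁻ z, ENNReal.ofReal (cost z.1 z.2) ∂π =
      ENNReal.ofReal (ε * ∫ z, scaledCost ε z.1 z.2 ∂π) := by
  have h : ∀ z : Rd d × Rd d, cost z.1 z.2 = ε * scaledCost ε z.1 z.2 := fun z => by
    rw [cost, scaledCost, mul_div_cancel₀ _ hε.ne']
  simp only [h]
  rw [← ofReal_integral_eq_lintegral_ofReal (hi.const_mul ε)
    (ae_of_all _ fun z => mul_nonneg hε.le (scaledCost_nonneg hε _ _)), integral_const_mul]

/-- Weak duality. -/
lemma ofReal_le_entropicOT (hε : 0 < ε) (hη : 0 < η)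
    (hμ : HasExpSqMoment η M (μ : Measure (Rd d))) (hν : HasExpSqMoment η M (ν : Measure (Rd d)))
    {u v : Rd d → ℝ} (hu : Tame ε K u) (hv : Tame ε L v)
    (hp : Integrable (density ε u v) ((μ : Measure (Rd d)).prod ν)) :
    ENNReal.ofReal (ε * dualValue ε μ ν u v) ≤ entropicOT ε μ ν := by
  refine le_iInf₂ fun π hπ => ?_
  have := isProbabilityMeasure_of_mem_plans hπ
  have hc := integrable_scaledCost_of_mem_plans hε hη hμ hν hπ
  obtain ⟨iu, eu⟩ := integrable_fst_of_mem_plans hπ (hu.integrable hε hη hμ)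
  obtain ⟨iv, ev⟩ := integrable_snd_of_mem_plans hπ (hv.integrable hε hη hν)
  have iuv : Integrable (fun z : Rd d × Rd d => u z.1 + v z.2) π := iu.add iv
  have key := integral_sub_log_le_klDiv (ρ := (μ : Measure (Rd d)).prod ν)
    (h := fun z => u z.1 + v z.2 - scaledCost ε z.1 z.2) (iuv.sub hc) hp
  have hc0 : 0 ≤ ∫ z, scaledCost ε z.1 z.2 ∂π :=
    integral_nonneg fun z => scaledCost_nonneg hε _ _
  refine le_trans ?_ (add_le_add_right (mul_le_mul_right key _) _)
  rw [lintegral_cost_eq hε hc, ← ENNReal.ofReal_mul hε.le]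
  refine le_trans (ENNReal.ofReal_le_ofReal ?_) ENNReal.ofReal_add_le
  rw [integral_sub iuv hc, integral_add iu iv, eu, ev]
  have hpos : 0 < ∫ z, density ε u v z ∂((μ : Measure (Rd d)).prod ν) := integral_exp_pos hp
  -- This replaces the logarithm of the Donsker–Varadhan bound by the linear term of `dualValue`.
  have hlog := Real.log_le_sub_one_of_pos hpos
  have he : ∫ z, Real.exp (u z.1 + v z.2 - scaledCost ε z.1 z.2) ∂((μ : Measure (Rd d)).prod ν) =
    ∫ z, density ε u v z ∂((μ : Measure (Rd d)).prod ν) := rfl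
  rw [he, ← mul_add]
  refine mul_le_mul_of_nonneg_left ?_ hε.le
  rw [dualValue]
  linarith

lemma map_snd_withDensity_density {μ ν : Measure (Rd d)} [SFinite μ] [SFinite ν]
    {u v : Rd d → ℝ} (hu : Measurable u) (hv : Measurable v) (h : HasUnitMarginal ε μ u v) :
    ((μ.prod ν).withDensity fun z => ENNReal.ofReal (density ε u v z)).snd = ν := by
  ext s hs
  rw [Measure.snd_apply hs, withDensity_apply _ (measurable_snd hs),
    ← lintegral_indicator (measurable_snd hs),
    lintegral_prod_symm' _
      ((measurable_density ε hu hv).ennreal_ofReal.indicator (measurable_snd hs)),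
    ← lintegral_indicator_one hs]
  congr 1 with y
  by_cases hy : y ∈ s
  · have : ∀ x, (Prod.snd ⁻¹' s).indicator (fun z => ENNReal.ofReal (density ε u v z)) (x, y) =
        ENNReal.ofReal (density ε u v (x, y)) := fun x => by simp [hy]
    simp only [this, Set.indicator_of_mem hy]
    have hi : Integrable (fun x => density ε u v (x, y)) μ :=
      Integrable.of_integral_ne_zero (by rw [h y]; exact one_ne_zero)
    rw [← ofReal_integral_eq_lintegral_ofReal hi
      (ae_of_all _ fun x => (density_pos ε u v _).le), h y]
    simp
  · simp [hy]

lemma map_fst_withDensity_density {μ ν : Measure (Rd d)} [SFinite μ] [SFinite ν]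
    {u v : Rd d → ℝ} (hu : Measurable u) (hv : Measurable v) (h : HasUnitMarginal ε ν v u) :
    ((μ.prod ν).withDensity fun z => ENNReal.ofReal (density ε u v z)).fst = μ := by
  ext s hs
  rw [Measure.fst_apply hs, withDensity_apply _ (measurable_fst hs),
    ← lintegral_indicator (measurable_fst hs),
    lintegral_prod _
      ((measurable_density ε hu hv).ennreal_ofReal.indicator (measurable_fst hs)).aemeasurable,
    ← lintegral_indicator_one hs]
  congr 1 with y
  have hs' : ∀ x, density ε u v (y, x) = density ε v u (x, y) :=
    fun x => density_swap ε u v (x, y)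
  by_cases hy : y ∈ s
  · have : ∀ x, (Prod.fst ⁻¹' s).indicator (fun z => ENNReal.ofReal (density ε u v z)) (y, x) =
        ENNReal.ofReal (density ε v u (x, y)) := fun x => by simp [hy, hs']
    simp only [this, Set.indicator_of_mem hy]
    have hi : Integrable (fun x => density ε v u (x, y)) ν :=
      Integrable.of_integral_ne_zero (by rw [h y]; exact one_ne_zero)
    rw [← ofReal_integral_eq_lintegral_ofReal hi
      (ae_of_all _ fun x => (density_pos ε v u _).le), h y]
    simp
  · simp [hy]

lemma IsPotentialPair.hasUnitMarginal {μ ν : Measure (Rd d)} [IsProbabilityMeasure μ]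
    {u v : Rd d → ℝ} (h : IsPotentialPair ε μ ν u v) (hε : 0 < ε) (hη : 0 < η)
    (hμ : HasExpSqMoment η M μ) (hu : Tame ε K u) : HasUnitMarginal ε μ u v := by
  rw [h.right]
  exact hasUnitMarginal_softTransform hε hη hμ hu

lemma IsPotentialPair.symm {μ ν : Measure (Rd d)} {u v : Rd d → ℝ}
    (h : IsPotentialPair ε μ ν u v) : IsPotentialPair ε ν μ v u := ⟨h.right, h.left⟩

/-- Strong duality: Schrödinger potentials compute the entropic transport cost. -/
theorem entropicOT_eq (hε : 0 < ε) (hη : 0 < η)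
    (hμ : HasExpSqMoment η M (μ : Measure (Rd d))) (hν : HasExpSqMoment η M (ν : Measure (Rd d)))
    {u v : Rd d → ℝ} (hu : Tame ε K u) (hv : Tame ε L v)
    (h : IsPotentialPair ε (μ : Measure (Rd d)) ν u v) :
    0 ≤ dualValue ε μ ν u v ∧ entropicOT ε μ ν = ENNReal.ofReal (ε * dualValue ε μ ν u v) := by
  have m₁ := h.hasUnitMarginal hε hη hμ hu
  have m₂ := h.symm.hasUnitMarginal hε hη hν hv
  rw [m₁.dualValue_eq (ν := (ν : Measure (Rd d))) hu.measurable hv.measurable]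
  set π := ((μ : Measure (Rd d)).prod (ν : Measure (Rd d))).withDensity
    fun z => ENNReal.ofReal (Real.exp (u z.1 + v z.2 - scaledCost ε z.1 z.2)) with hπdef
  have hπ : π ∈ plans μ ν := ⟨map_fst_withDensity_density hu.measurable hv.measurable m₂,
    map_snd_withDensity_density hu.measurable hv.measurable m₁⟩
  have := isProbabilityMeasure_of_mem_plans hπ
  have hc := integrable_scaledCost_of_mem_plans hε hη hμ hν hπ
  obtain ⟨iu, eu⟩ := integrable_fst_of_mem_plans hπ (hu.integrable hε hη hμ)
  obtain ⟨iv, ev⟩ := integrable_snd_of_mem_plans hπ (hv.integrable hε hη hν)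
  have iuv : Integrable (fun z : Rd d × Rd d => u z.1 + v z.2) π := iu.add iv
  obtain ⟨hgibbs, hkl⟩ := klDiv_withDensity_exp
    (h := fun z : Rd d × Rd d => u z.1 + v z.2 - scaledCost ε z.1 z.2)
    (((hu.measurable.comp measurable_fst).add (hv.measurable.comp measurable_snd)).sub
      (measurable_scaledCost ε measurable_fst measurable_snd)) (iuv.sub hc)
  have hc0 : 0 ≤ ∫ z, scaledCost ε z.1 z.2 ∂π :=
    integral_nonneg fun z => scaledCost_nonneg hε _ _
  have hsum : ∫ z, (u z.1 + v z.2 - scaledCost ε z.1 z.2) ∂π =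
      ∫ x, u x ∂(μ : Measure (Rd d)) + ∫ y, v y ∂(ν : Measure (Rd d)) -
        ∫ z, scaledCost ε z.1 z.2 ∂π := by
    rw [integral_sub iuv hc, integral_add iu iv, eu, ev]
  rw [← hπdef, hsum] at hgibbs
  refine ⟨by linarith, le_antisymm ?_ ?_⟩
  · refine (iInf₂_le π hπ).trans ?_
    rw [lintegral_cost_eq hε hc, hkl, ← hπdef, ← ENNReal.ofReal_mul hε.le, hsum,
      ← ENNReal.ofReal_add (mul_nonneg hε.le hc0) (mul_nonneg hε.le hgibbs)]
    refine ENNReal.ofReal_le_ofReal (le_of_eq ?_)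
    ring
  · rw [← m₁.dualValue_eq (ν := (ν : Measure (Rd d))) hu.measurable hv.measurable]
    exact ofReal_le_entropicOT hε hη hμ hν hu hv (m₁.integrable hu.measurable hv.measurable)

lemma IsPotentialPair.toReal_entropicOT (hε : 0 < ε) (hη : 0 < η)
    (hμ : HasExpSqMoment η M (μ : Measure (Rd d))) (hν : HasExpSqMoment η M (ν : Measure (Rd d)))
    {u v : Rd d → ℝ} (hu : Tame ε K u) (hv : Tame ε L v)
    (h : IsPotentialPair ε (μ : Measure (Rd d)) ν u v) :
    (entropicOT ε μ ν).toReal = ε * dualValue ε μ ν u v := by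
  obtain ⟨h0, he⟩ := entropicOT_eq hε hη hμ hν hu hv h
  rw [he, ENNReal.toReal_ofReal (mul_nonneg hε.le h0)]

end Plans

/-- Schrödinger potentials maximize the dual objective. -/
lemma IsPotentialPair.dualValue_le {μ ν : Measure (Rd d)} [IsProbabilityMeasure μ]
    [IsProbabilityMeasure ν] (hε : 0 < ε) (hη : 0 < η)
    (hμ : HasExpSqMoment η M μ) (hν : HasExpSqMoment η M ν)
    {L' : ℝ} {u v u' v' : Rd d → ℝ} (hu : Tame ε K u) (hv : Tame ε K v)
    (h : IsPotentialPair ε μ ν u v) (hu' : Tame ε L u') (hv' : Tame ε L' v')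
    (hp : Integrable (density ε u' v') (μ.prod ν)) :
    dualValue ε μ ν u' v' ≤ dualValue ε μ ν u v := by
  -- Maximality is read off the primal side: weak duality bounds every dual value by the cost, which
  -- this pair attains.
  obtain ⟨h0, he⟩ := entropicOT_eq (μ := ⟨μ, inferInstance⟩) (ν := ⟨ν, inferInstance⟩)
    hε hη hμ hν hu hv h
  have h1 := ofReal_le_entropicOT (μ := ⟨μ, inferInstance⟩) (ν := ⟨ν, inferInstance⟩)
    hε hη hμ hν hu' hv' hp
  rw [he, ENNReal.ofReal_le_ofReal_iff (mul_nonneg hε.le h0)] at h1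
  exact le_of_mul_le_mul_left h1 hε

end

/-! ### Mixtures of measures -/

section

variable {d : ℕ} {ε η M K L s : ℝ} {μ μ' ν ν' : Measure (Rd d)}

/-- The mixture `(1 - s) μ + s μ'`. -/
noncomputable def mix {X : Type*} [MeasurableSpace X] (s : ℝ) (μ μ' : Measure X) : Measure X :=
  ENNReal.ofReal (1 - s) • μ + ENNReal.ofReal s • μ'

lemma isProbabilityMeasure_mix {X : Type*} [MeasurableSpace X] {μ μ' : Measure X}
    [IsProbabilityMeasure μ] [IsProbabilityMeasure μ'] (h0 : 0 ≤ s)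
    (h1 : s ≤ 1) : IsProbabilityMeasure (mix s μ μ') := by
  constructor
  simp only [mix, Measure.coe_add, Measure.coe_smul, Pi.add_apply, Pi.smul_apply, measure_univ,
    smul_eq_mul, mul_one]
  rw [← ENNReal.ofReal_add (by linarith) h0]
  simp

section Mix

variable {X : Type*} [MeasurableSpace X] {μ μ' : Measure X} {f : X → ℝ}

lemma integrable_mix (hf : Integrable f μ) (hf' : Integrable f μ') : Integrable f (mix s μ μ') :=
  (hf.smul_measure ENNReal.ofReal_ne_top).add_measure (hf'.smul_measure ENNReal.ofReal_ne_top)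

lemma integrable_of_mix (h0 : 0 < s) (h1 : s < 1) (hf : Integrable f (mix s μ μ')) :
    Integrable f μ ∧ Integrable f μ' := by
  rw [mix, integrable_add_measure, integrable_smul_measure (by simpa using h1) (by simp),
    integrable_smul_measure (by simpa using h0) (by simp)] at hf
  exact hf

lemma integral_mix (h0 : 0 ≤ s) (h1 : s ≤ 1) (hf : Integrable f μ) (hf' : Integrable f μ') :
    ∫ x, f x ∂(mix s μ μ') = (1 - s) * ∫ x, f x ∂μ + s * ∫ x, f x ∂μ' := by
  rw [mix, integral_add_measure (hf.smul_measure ENNReal.ofReal_ne_top)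
    (hf'.smul_measure ENNReal.ofReal_ne_top), integral_smul_measure, integral_smul_measure,
    ENNReal.toReal_ofReal (by linarith), ENNReal.toReal_ofReal h0]
  simp

lemma mix_prod {Y : Type*} [MeasurableSpace Y] {ν : Measure Y} [SFinite ν] [SFinite μ]
    [SFinite μ'] : (mix s μ μ').prod ν = mix s (μ.prod ν) (μ'.prod ν) := by
  rw [mix, mix, Measure.add_prod, Measure.prod_smul_left, Measure.prod_smul_left]

lemma prod_mix {Y : Type*} [MeasurableSpace Y] {ν ν' : Measure Y} [SFinite ν] [SFinite μ]
    [SFinite ν'] : μ.prod (mix s ν ν') = mix s (μ.prod ν) (μ.prod ν') := by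
  rw [mix, mix, Measure.prod_add, Measure.prod_smul_right, Measure.prod_smul_right]

end Mix

lemma HasExpSqMoment.mix (hμ : HasExpSqMoment η M μ) (hμ' : HasExpSqMoment η M μ') (h0 : 0 ≤ s)
    (h1 : s ≤ 1) : HasExpSqMoment η M (mix s μ μ') := by
  refine ⟨integrable_mix hμ.integrable hμ'.integrable, ?_⟩
  rw [integral_mix h0 h1 hμ.integrable hμ'.integrable]
  nlinarith [hμ.le, hμ'.le]

variable [IsProbabilityMeasure μ] [IsProbabilityMeasure μ'] [IsProbabilityMeasure ν]
  [IsProbabilityMeasure ν']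

lemma exp_neg_softTransform_mix (hε : 0 < ε) (hη : 0 < η) (hμ : HasExpSqMoment η M μ)
    (hμ' : HasExpSqMoment η M μ') (h0 : 0 ≤ s) (h1 : s ≤ 1) {u : Rd d → ℝ} (hu : Tame ε K u)
    (y : Rd d) :
    Real.exp (-softTransform ε (mix s μ μ') u y) =
      (1 - s) * Real.exp (-softTransform ε μ u y) + s * Real.exp (-softTransform ε μ' u y) := by
  have := isProbabilityMeasure_mix (μ := μ) (μ' := μ') h0 h1
  rw [hu.exp_neg_softTransform hε hη (hμ.mix hμ' h0 h1), hu.exp_neg_softTransform hε hη hμ,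
    hu.exp_neg_softTransform hε hη hμ',
    integral_mix h0 h1 (hu.integrable_exp hε hη hμ y) (hu.integrable_exp hε hη hμ' y)]

/-- exp(-T_μ u) is affine in μ, and the part due to μ' is σ n times a bounded quantity. -/
lemma tendsto_softTransform_mix (hε : 0 < ε) (hη : 0 < η) (hμ : HasExpSqMoment η M μ)
    (hμ' : HasExpSqMoment η M μ') {σ : ℕ → ℝ} (hσ : ∀ n, 0 ≤ σ n ∧ σ n ≤ 1)
    (hσ0 : Tendsto σ atTop (𝓝 0)) {U : ℕ → Rd d → ℝ} {w : Rd d → ℝ} (hU : ∀ n, Tame ε K (U n))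
    (h : ∀ᵐ x ∂μ, Tendsto (fun n => U n x) atTop (𝓝 (w x))) (y : Rd d) :
    Tendsto (fun n => softTransform ε (mix (σ n) μ μ') (U n) y) atTop
      (𝓝 (softTransform ε μ w y)) := by
  have t1 := (Real.continuous_exp.tendsto _).comp (tendsto_softTransform hε hη hμ hU h y).neg
  have t2 : Tendsto (fun n => σ n * Real.exp (-softTransform ε μ' (U n) y)) atTop (𝓝 0) := by
    refine squeeze_zero (fun n => mul_nonneg (hσ n).1 (Real.exp_nonneg _))
      (fun n => mul_le_mul_of_nonneg_left (Real.exp_le_exp.2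
        (neg_le.1 (((hU n).softTransform hε hη hμ').lower y))) (hσ n).1) ?_
    simpa using hσ0.mul_const _
  have t3 := ((hσ0.const_sub 1).mul t1).add t2
  simp only [sub_zero, one_mul, add_zero, Function.comp] at t3
  have t4 := (Real.continuousAt_log (Real.exp_pos _).ne').tendsto.comp t3
  rw [Real.log_exp] at t4
  have t5 := t4.neg
  rw [neg_neg] at t5
  refine t5.congr fun n => ?_
  simp only [Function.comp]
  rw [← exp_neg_softTransform_mix hε hη hμ hμ' (hσ n).1 (hσ n).2 (hU n), Real.log_exp, neg_neg]

/-- Value of the dual objective at the base measures, in terms of the displaced measures. -/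
lemma dualValue_base_eq (hε : 0 < ε) (hη : 0 < η) (hμ : HasExpSqMoment η M μ)
    (hμ' : HasExpSqMoment η M μ') (hν : HasExpSqMoment η M ν) (hν' : HasExpSqMoment η M ν')
    (h0 : 0 < s) (h1 : s < 1) {u v : Rd d → ℝ} (hu : Tame ε K u) (hv : Tame ε K v)
    (h : IsPotentialPair ε (mix s μ μ') (mix s ν ν') u v) :
    Integrable (density ε u v) (μ.prod ν) ∧ Integrable (density ε u v) (μ'.prod ν') ∧
    dualValue ε μ ν u v = dualValue ε (mix s μ μ') (mix s ν ν') u v -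
      s * (∫ x, u x ∂μ' - ∫ x, u x ∂μ + (∫ y, v y ∂ν' - ∫ y, v y ∂ν)) +
      s ^ 2 * (1 - ∫ z, density ε u v z ∂(μ'.prod ν')) / (1 - s) ^ 2 := by
  have i1 := isProbabilityMeasure_mix (μ := μ) (μ' := μ') h0.le h1.le
  have i2 := isProbabilityMeasure_mix (μ := ν) (μ' := ν') h0.le h1.le
  have hmμ := hμ.mix hμ' h0.le h1.le
  have hmν := hν.mix hν' h0.le h1.le
  have m₁ := h.hasUnitMarginal hε hη hmμ hu
  have m₂ := h.symm.hasUnitMarginal hε hη hmν hv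
  -- The marginal condition of the displaced problem is integrated against ρ, later ν and ν'.
  have left : ∀ (ρ : Measure (Rd d)) [IsProbabilityMeasure ρ],
      Integrable (density ε u v) (μ.prod ρ) ∧ Integrable (density ε u v) (μ'.prod ρ) ∧
      (1 - s) * ∫ z, density ε u v z ∂(μ.prod ρ) + s * ∫ z, density ε u v z ∂(μ'.prod ρ) = 1 := by
    intro ρ _
    have hi := m₁.integrable (ν := ρ) hu.measurable hv.measurable
    have he := m₁.integral_eq (ν := ρ) hu.measurable hv.measurable
    rw [mix_prod] at hi he
    obtain ⟨a, b⟩ := integrable_of_mix h0 h1 hi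
    exact ⟨a, b, by rw [← integral_mix h0.le h1.le a b, he]⟩
  have right : (1 - s) * ∫ z, density ε u v z ∂(μ.prod ν) +
      s * ∫ z, density ε u v z ∂(μ.prod ν') = 1 := by
    have he : ∫ z, density ε u v z ∂(μ.prod (mix s ν ν')) = 1 := by
      rw [← m₂.integral_eq (ν := μ) hv.measurable hu.measurable]
      have := integral_density_swap (ε := ε) (μ := μ) (ν := mix s ν ν') (u := u) (v := v)
        (fun _ => 1)
      simpa using this.symm
    rw [prod_mix] at he
    rw [← integral_mix h0.le h1.le (left ν).1 (left ν').1, he]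
  refine ⟨(left ν).1, (left ν').2.1, ?_⟩
  rw [m₁.dualValue_eq hu.measurable hv.measurable,
    integral_mix h0.le h1.le (hu.integrable hε hη hμ) (hu.integrable hε hη hμ'),
    integral_mix h0.le h1.le (hv.integrable hε hη hν) (hv.integrable hε hη hν'), dualValue]
  have l2 := (left ν').2.2
  have hs : 1 - s ≠ 0 := by linarith
  set a := ∫ z, density ε u v z ∂(μ.prod ν)
  set b := ∫ z, density ε u v z ∂(μ.prod ν')
  set e := ∫ z, density ε u v z ∂(μ'.prod ν')
  -- Eliminating the mixed integral b between the two marginal relations gives 1 - a = s² (1 - e) /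
  -- (1 - s)², with no explicit first-order term.
  have hb : b = (1 - s * e) / (1 - s) := by field_simp; linarith
  have ha : a = (1 - s * b) / (1 - s) := by field_simp; linarith
  rw [ha, hb]
  field_simp
  ring

end

/-! ### First-order estimates and stability of potentials -/

section

variable {d : ℕ} {ε η M K L s : ℝ} {α α' β β' : Measure (Rd d)} [IsProbabilityMeasure α]
  [IsProbabilityMeasure α'] [IsProbabilityMeasure β] [IsProbabilityMeasure β'] {u v : Rd d → ℝ}

/-- The logarithmic correction between a potential and its update for a displaced measure. -/
noncomputable def mixLog (ε : ℝ) (β' : Measure (Rd d)) (u v : Rd d → ℝ) (s : ℝ) (x : Rd d) : ℝ :=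
  Real.log (1 - s + s * Real.exp (u x - softTransform ε β' v x))

lemma mixLog_arg_pos {b : ℝ} (h0 : 0 ≤ s) (h1 : s < 1) (hb : 0 < b) : 0 < 1 - s + s * b := by
  nlinarith [mul_nonneg h0 hb.le]

lemma softTransform_mix_eq (hε : 0 < ε) (hη : 0 < η) (hβ : HasExpSqMoment η M β)
    (hβ' : HasExpSqMoment η M β') (h0 : 0 ≤ s) (h1 : s < 1) (hv : Tame ε K v)
    (h : u = softTransform ε β v) (x : Rd d) :
    softTransform ε (mix s β β') v x = u x - mixLog ε β' u v s x := by
  have he := exp_neg_softTransform_mix hε hη hβ hβ' h0 h1.le hv x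
  rw [← h] at he
  have : Real.exp (-softTransform ε (mix s β β') v x) =
      Real.exp (-u x) * (1 - s + s * Real.exp (u x - softTransform ε β' v x)) := by
    rw [he, sub_eq_add_neg (u x), Real.exp_add, Real.exp_neg (u x)]
    field_simp
  have h2 := congrArg Real.log this
  rw [Real.log_exp, Real.log_mul (Real.exp_pos _).ne' (mixLog_arg_pos h0 h1 (Real.exp_pos _)).ne',
    Real.log_exp] at h2
  unfold mixLog
  linarith

/-- The competitor for the displaced problem is (w, v), with w the transform of v against the
displaced β. No information on the displaced potentials beyond maximality is needed. -/
lemma dualValue_mix_ge (hε : 0 < ε) (hη : 0 < η) (hα : HasExpSqMoment η M α)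
    (hα' : HasExpSqMoment η M α') (hβ : HasExpSqMoment η M β) (hβ' : HasExpSqMoment η M β')
    (hu : Tame ε K u) (hv : Tame ε K v) (h : IsPotentialPair ε α β u v)
    (h0 : 0 < s) (h1 : s < 1) {U V : Rd d → ℝ} (hU : Tame ε L U) (hV : Tame ε L V)
    (hUV : IsPotentialPair ε (mix s α α') (mix s β β') U V) :
    dualValue ε α β u v + s * (∫ x, u x ∂α' - ∫ x, u x ∂α + (∫ y, v y ∂β' - ∫ y, v y ∂β)) -
      s * ∫ x, mixLog ε β' u v s x ∂α' ≤ dualValue ε (mix s α α') (mix s β β') U V := by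
  have i1 := isProbabilityMeasure_mix (μ := α) (μ' := α') h0.le h1.le
  have i2 := isProbabilityMeasure_mix (μ := β) (μ' := β') h0.le h1.le
  have hmα := hα.mix hα' h0.le h1.le
  have hmβ := hβ.mix hβ' h0.le h1.le
  have m := h.hasUnitMarginal hε hη hα hu
  set w := softTransform ε (mix s β β') v with hw
  have tw : Tame ε _ w := hv.softTransform hε hη hmβ
  have hwl : ∀ x, w x = u x - mixLog ε β' u v s x :=
    softTransform_mix_eq hε hη hβ hβ' h0.le h1 hv h.left
  have hl : ∀ x, mixLog ε β' u v s x = u x - w x := fun x => by rw [hwl]; ring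
  have mw : HasUnitMarginal ε (mix s β β') v w := hasUnitMarginal_softTransform hε hη hmβ hv
  have key := hUV.dualValue_le hε hη hmα hmβ hU hV tw hv
    (integrable_density_swap (mw.integrable hv.measurable tw.measurable))
  rw [← dualValue_swap, mw.dualValue_eq hv.measurable tw.measurable,
    integral_mix h0.le h1.le (hv.integrable hε hη hβ) (hv.integrable hε hη hβ'),
    integral_mix h0.le h1.le (tw.integrable hε hη hα) (tw.integrable hε hη hα')] at key
  rw [m.dualValue_eq hu.measurable hv.measurable]
  have hα'w : ∫ x, mixLog ε β' u v s x ∂α' = ∫ x, u x ∂α' - ∫ x, w x ∂α' := by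
    simp only [hl]
    exact integral_sub (hu.integrable hε hη hα') (tw.integrable hε hη hα')
  -- By log r ≤ r - 1 the loss is at most s (∫∫ exp(u + v - c) d(α ⊗ β') - 1), which vanishes since
  -- the marginal condition holds at all y. Only the α' part, of weight s, survives.
  have hαw : ∫ x, u x ∂α - ∫ x, w x ∂α ≤ 0 := by
    rw [← integral_sub (hu.integrable hε hη hα) (tw.integrable hε hη hα)]
    obtain ⟨hi, he⟩ := integral_density_eq (ν := α) (v := u) hε hη hβ' hv
      (integrable_density_swap (m.integrable (ν := β') hu.measurable hv.measurable))
    have h1' : ∫ z, density ε v u z ∂(β'.prod α) = 1 := by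
      rw [← m.integral_eq (ν := β') hu.measurable hv.measurable]
      have := integral_density_swap (ε := ε) (μ := α) (ν := β') (u := u) (v := v) (fun _ => 1)
      simpa using this
    rw [h1'] at he
    have : ∫ x, (u x - w x) ∂α ≤
        ∫ x, s * (Real.exp (u x - softTransform ε β' v x) - 1) ∂α := by
      refine integral_mono ((hu.integrable hε hη hα).sub (tw.integrable hε hη hα))
        ((hi.sub (integrable_const 1)).const_mul s) fun x => ?_
      simp only [← hl]
      refine (Real.log_le_sub_one_of_pos (mixLog_arg_pos h0.le h1 (Real.exp_pos _))).trans ?_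
      linarith
    rw [integral_const_mul, integral_sub hi (integrable_const 1), ← he] at this
    simpa using this
  rw [hα'w]
  nlinarith

lemma tendsto_integral_mixLog (hε : 0 < ε) (hη : 0 < η) (hα' : HasExpSqMoment η M α')
    (hβ' : HasExpSqMoment η M β') (hu : Tame ε K u) (hv : Tame ε K v) :
    Tendsto (fun s => ∫ x, mixLog ε β' u v s x ∂α') (𝓝[>] 0) (𝓝 0) := by
  have tw := hv.softTransform hε hη hβ'
  -- For s < 1/2 the argument of the logarithm lies between 1/2 and 2 exp |t|, with t = u - T_β' v.
  have hi : Integrable (fun x => Real.log 2 + |u x - softTransform ε β' v x|) α' :=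
    (integrable_const _).add ((hu.integrable hε hη hα').sub (tw.integrable hε hη hα')).abs
  have hev : ∀ᶠ s : ℝ in 𝓝[>] 0, s ∈ Set.Ioo (0 : ℝ) (1 / 2) :=
    Ioo_mem_nhdsGT (by norm_num)
  have h := tendsto_integral_filter_of_dominated_convergence (μ := α') (l := 𝓝[>] (0 : ℝ))
    (F := fun s x => mixLog ε β' u v s x) (f := fun _ => 0) _ ?_ ?_ hi ?_
  · simpa using h
  · refine Eventually.of_forall fun s => Measurable.aestronglyMeasurable ?_
    exact ((((hu.measurable.sub tw.measurable).exp).const_mul s).const_add (1 - s)).log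
  · filter_upwards [hev] with s hs
    refine ae_of_all _ fun x => ?_
    set t := u x - softTransform ε β' v x
    have ht := Real.exp_pos t
    have h1 : Real.exp t ≤ Real.exp |t| := Real.exp_le_exp.2 (le_abs_self t)
    have h2 : 1 ≤ Real.exp |t| := Real.one_le_exp (abs_nonneg t)
    have hp := mixLog_arg_pos hs.1.le (by linarith [hs.2]) ht
    have hle : Real.log (1 - s + s * Real.exp t) ≤ Real.log 2 + |t| := by
      rw [← Real.log_exp |t|, ← Real.log_mul (by norm_num) (Real.exp_pos _).ne']
      refine Real.log_le_log hp ?_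
      nlinarith [hs.1, hs.2, mul_le_mul_of_nonneg_left h1 hs.1.le]
    have hge : -Real.log 2 ≤ Real.log (1 - s + s * Real.exp t) := by
      rw [← Real.log_inv]
      refine Real.log_le_log (by norm_num) ?_
      nlinarith [hs.2, mul_nonneg hs.1.le ht.le]
    change |Real.log (1 - s + s * Real.exp t)| ≤ Real.log 2 + |t|
    exact abs_le.2 ⟨by linarith [abs_nonneg t], hle⟩
  · refine ae_of_all _ fun x => ?_
    have hc : ContinuousAt (fun s => mixLog ε β' u v s x) 0 := by
      unfold mixLog
      refine ContinuousAt.log (by fun_prop) (by simp)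
    have h2 := hc.tendsto.mono_left (nhdsWithin_le_nhds (s := Set.Ioi 0))
    simpa [mixLog] using h2

/-- The second order term in the displacement is `o(s)`. -/
lemma tendsto_mul_integral_density (hε : 0 < ε) (hη : 0 < η)
    (hβ : HasExpSqMoment η M β) (hβ' : HasExpSqMoment η M β') {U V : ℝ → Rd d → ℝ}
    (hU : ∀ s, Tame ε K (U s)) (hV : ∀ s, Tame ε K (V s))
    (h : ∀ s, 0 < s → s < 1 → U s = softTransform ε (mix s β β') (V s) ∧
      Integrable (density ε (U s) (V s)) (α'.prod β')) :
    Tendsto (fun s => s * ∫ z, density ε (U s) (V s) z ∂(α'.prod β')) (𝓝[>] 0) (𝓝 0) := by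
  have tw := fun s => (hV s).softTransform hε hη hβ'
  have hev : ∀ᶠ s : ℝ in 𝓝[>] 0, s ∈ Set.Ioo (0 : ℝ) 1 := Ioo_mem_nhdsGT (by norm_num)
  have key := tendsto_integral_filter_of_dominated_convergence (μ := α') (l := 𝓝[>] (0 : ℝ))
    (F := fun s x => s * Real.exp (U s x - softTransform ε β' (V s) x)) (f := fun _ => 0)
    (fun _ => 1) ?_ ?_ (integrable_const _) ?_
  · rw [integral_zero] at key
    refine key.congr' ?_
    filter_upwards [hev] with s hs
    obtain ⟨-, he⟩ := integral_density_eq (ν := α') (v := U s) hε hη hβ' (hV s)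
      (integrable_density_swap (h s hs.1 hs.2).2)
    rw [integral_const_mul, ← he]
    have := integral_density_swap (ε := ε) (μ := α') (ν := β') (u := U s) (v := V s) (fun _ => 1)
    simp only [mul_one] at this
    rw [this]
  · exact Eventually.of_forall fun s => Measurable.aestronglyMeasurable
      ((((hU s).measurable.sub (tw s).measurable).exp).const_mul s)
  · filter_upwards [hev] with s hs
    refine ae_of_all _ fun x => ?_
    have hpos : 0 ≤ s * Real.exp (U s x - softTransform ε β' (V s) x) :=
      mul_nonneg hs.1.le (Real.exp_nonneg _)
    rw [Real.norm_of_nonneg hpos]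
    have he := exp_neg_softTransform_mix hε hη hβ hβ' hs.1.le hs.2.le (hV s) x
    rw [← (h s hs.1 hs.2).1] at he
    -- The mixture dominates s β'; this yields the dominating constant 1.
    have h2 : s * Real.exp (-softTransform ε β' (V s) x) ≤ Real.exp (-U s x) := by
      rw [he]
      have := mul_nonneg (sub_nonneg.2 hs.2.le) (Real.exp_nonneg (-softTransform ε β (V s) x))
      linarith
    calc s * Real.exp (U s x - softTransform ε β' (V s) x)
        = s * Real.exp (-softTransform ε β' (V s) x) * Real.exp (U s x) := by
          rw [mul_assoc, ← Real.exp_add]; ring_nf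
      _ ≤ Real.exp (-U s x) * Real.exp (U s x) := by gcongr
      _ = 1 := by rw [← Real.exp_add]; simp
  · refine ae_of_all _ fun x => ?_
    have ht : Tendsto (fun s : ℝ => s) (𝓝[>] 0) (𝓝 0) :=
      tendsto_id.mono_left nhdsWithin_le_nhds
    refine squeeze_zero' (t₀ := 𝓝[>] (0 : ℝ)) (g := fun s => s *
      Real.exp (‖x‖ ^ 2 / ε + K * (1 + ‖x‖) +
      transformBound ε η M ((2 * K + 1 / ε) * (1 + M / η)) * (1 + ‖x‖ ^ 2))) ?_ ?_ ?_
    · filter_upwards [hev] with s hs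
      exact mul_nonneg hs.1.le (Real.exp_nonneg _)
    · filter_upwards [hev] with s hs
      refine mul_le_mul_of_nonneg_left (Real.exp_le_exp.2 ?_) hs.1.le
      have := (hU s).upper x
      have := (tw s).lower x
      linarith
    · simpa using ht.mul_const _

/-- Stability of the potentials: nearly maximizing potentials of displaced measures converge, up to
constants. -/
lemma exists_subseq_tendsto_potentials (hε : 0 < ε) (hη : 0 < η) (hα : HasExpSqMoment η M α)
    (hα' : HasExpSqMoment η M α') (hβ : HasExpSqMoment η M β) (hβ' : HasExpSqMoment η M β')
    (hu : Tame ε K u) (hv : Tame ε K v) (h : IsPotentialPair ε α β u v)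
    {σ : ℕ → ℝ} (hσ : ∀ n, 0 < σ n ∧ σ n < 1) (hσ0 : Tendsto σ atTop (𝓝 0))
    {U V : ℕ → Rd d → ℝ} (hU : ∀ n, Tame ε K (U n)) (hV : ∀ n, Tame ε K (V n))
    (hUV : ∀ n, IsPotentialPair ε (mix (σ n) α α') (mix (σ n) β β') (U n) (V n))
    (hp : ∀ n, Integrable (density ε (U n) (V n)) (α.prod β))
    (hD : Tendsto (fun n => dualValue ε α β (U n) (V n)) atTop (𝓝 (dualValue ε α β u v))) :
    ∃ φ : ℕ → ℕ, StrictMono φ ∧ ∃ k : ℝ, (∀ x, Tendsto (fun n => U (φ n) x) atTop (𝓝 (u x - k))) ∧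
      ∀ y, Tendsto (fun n => V (φ n) y) atTop (𝓝 (v y + k)) := by
  have m := h.hasUnitMarginal hε hη hα hu
  have p := m.integrable (ν := β) hu.measurable hv.measurable
  have hL : Tendsto (fun n => eLpNorm ((fun z => Real.sqrt (density ε (U n) (V n) z)) -
      fun z => Real.sqrt (density ε u v z)) 2 (α.prod β)) atTop (𝓝 0) := by
    have t : Tendsto (fun n => ENNReal.ofReal (Real.sqrt (dualValue ε α β u v -
        dualValue ε α β (U n) (V n)))) atTop (𝓝 0) := by
      have := ENNReal.tendsto_ofReal (Real.continuous_sqrt.continuousAt.tendsto.comp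
        (hD.const_sub (dualValue ε α β u v)))
      simpa using this
    refine tendsto_of_tendsto_of_tendsto_of_le_of_le tendsto_const_nhds t
      (fun _ => zero_le) fun n => ?_
    simp only
    rw [eLpNorm_sqrt_density_sub (hp n) p (hU n).measurable hu.measurable
      (hV n).measurable hv.measurable ((hU n).integrable hε hη hα)
      (hu.integrable hε hη hα) ((hV n).integrable hε hη hβ) (hv.integrable hε hη hβ)]
    refine ENNReal.ofReal_le_ofReal (Real.sqrt_le_sqrt ?_)
    have := h.dualValue_le hε hη hα hβ hu hv ((hU n).convex_comb hu) ((hV n).convex_comb hv)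
      (integrable_density_midpoint (hU n).measurable hu.measurable
      (hV n).measurable hv.measurable (hp n) p)
    linarith
  obtain ⟨φ, hφ, hae⟩ := (tendstoInMeasure_of_tendsto_eLpNorm (by norm_num)
    (fun n => (measurable_density ε (hU n).measurable (hV n).measurable).sqrt.aestronglyMeasurable)
    (measurable_density ε hu.measurable hv.measurable).sqrt.aestronglyMeasurable
    hL).exists_seq_tendsto_ae
  have hae' : ∀ᵐ z ∂(α.prod β), Tendsto (fun n => U (φ n) z.1 + V (φ n) z.2) atTop
      (𝓝 (u z.1 + v z.2)) := by
    filter_upwards [hae] with z hz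
    convert tendsto_add_of_tendsto_sqrt_density (fun n => hU (φ n)) (fun n => hV (φ n)) hz using 2
    simp only [density, ← Real.exp_half, Real.log_exp]
    ring
  obtain ⟨ψ, hψ, x₀, a, ha, hy⟩ := exists_subseq_tendsto_of_ae_prod (fun n => hU (φ n)) hae'
  have hσ' : Tendsto (fun n => σ (φ (ψ n))) atTop (𝓝 0) :=
    hσ0.comp (hφ.comp hψ).tendsto_atTop
  have hσb : ∀ n, 0 ≤ σ (φ (ψ n)) ∧ σ (φ (ψ n)) ≤ 1 := fun n => ⟨(hσ _).1.le, (hσ _).2.le⟩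
  -- Subtracting the convergent values at x₀ from the sums isolates V; the constant u x₀ - a is the
  -- freedom left in the limit.
  have hVae : ∀ᵐ y ∂β, Tendsto (fun n => V (φ (ψ n)) y) atTop (𝓝 (v y + (u x₀ - a))) := by
    filter_upwards [hy] with y hy
    have := (hy.comp hψ.tendsto_atTop).sub ha
    refine (this.congr fun n => ?_).trans (le_of_eq (by congr 1; ring))
    simp
  have hUt : ∀ x, Tendsto (fun n => U (φ (ψ n)) x) atTop (𝓝 (u x - (u x₀ - a))) := fun x => by
    have := tendsto_softTransform_mix hε hη hβ hβ' hσb hσ' (fun n => hV _) hVae x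
    rw [hv.softTransform_add_const hε hη hβ, ← h.left] at this
    exact this.congr fun n => (congrFun (hUV (φ (ψ n))).left x).symm
  refine ⟨φ ∘ ψ, hφ.comp hψ, u x₀ - a, hUt, fun y => ?_⟩
  have := tendsto_softTransform_mix hε hη hα hα' hσb hσ' (fun n => hU _) (ae_of_all _ hUt) y
  have e := hu.softTransform_add_const hε hη hα (-(u x₀ - a))
  rw [← h.right] at e
  simp only [← sub_eq_add_neg, sub_neg_eq_add] at e
  rw [e] at this
  exact this.congr fun n => (congrFun (hUV (φ (ψ n))).right y).symm

end

/-! ### One-sided derivative along mixtures -/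

section

variable {d : ℕ} {ε η M K : ℝ}

/-- The entropic cost has the expected one-sided derivative along mixtures. -/
lemma exists_forall_abs_entropicOT_sub_le (hε : 0 < ε) (hη : 0 < η)
    {α α' β β' : ProbabilityMeasure (Rd d)} (hα : HasExpSqMoment η M (α : Measure (Rd d)))
    (hα' : HasExpSqMoment η M (α' : Measure (Rd d)))
    (hβ : HasExpSqMoment η M (β : Measure (Rd d)))
    (hβ' : HasExpSqMoment η M (β' : Measure (Rd d))) {u v : Rd d → ℝ} (hu : Tame ε K u)
    (hv : Tame ε K v) (h : IsPotentialPair ε (α : Measure (Rd d)) β u v) {c : ℝ} (hc : 0 < c) :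
    ∃ r : ℝ, 0 < r ∧ ∀ s, 0 < s → s < r → ∀ αs βs : ProbabilityMeasure (Rd d),
      (αs : Measure (Rd d)) = mix s (α : Measure (Rd d)) α' →
      (βs : Measure (Rd d)) = mix s (β : Measure (Rd d)) β' →
      |(entropicOT ε αs βs).toReal - (entropicOT ε α β).toReal -
        s * (ε * (∫ x, u x ∂(α' : Measure (Rd d)) - ∫ x, u x ∂(α : Measure (Rd d)) +
          (∫ y, v y ∂(β' : Measure (Rd d)) - ∫ y, v y ∂(β : Measure (Rd d)))))| ≤ c * s := by
  obtain ⟨K', hK'⟩ := exists_potentialPair (d := d) hε hη M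
  set L := max K K' with hL
  replace hu : Tame ε L u := hu.mono (le_max_left _ _)
  replace hv : Tame ε L v := hv.mono (le_max_left _ _)
  set A : ℝ → Measure (Rd d) := fun s => mix s (α : Measure (Rd d)) α' with hA
  set B : ℝ → Measure (Rd d) := fun s => mix s (β : Measure (Rd d)) β' with hB
  -- Outside (0, 1) the base pair is a filler that keeps both families uniformly tame.
  have hex : ∀ s : ℝ, ∃ U V : Rd d → ℝ, Tame ε L U ∧ Tame ε L V ∧
      (0 < s → s < 1 → IsPotentialPair ε (A s) (B s) U V) := by
    intro s
    by_cases hs : 0 < s ∧ s < 1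
    · have i1 := isProbabilityMeasure_mix (μ := (α : Measure (Rd d))) (μ' := α') hs.1.le hs.2.le
      have i2 := isProbabilityMeasure_mix (μ := (β : Measure (Rd d))) (μ' := β') hs.1.le hs.2.le
      obtain ⟨U, V, hU, hV, hUV⟩ := hK' (A s) (B s) (hα.mix hα' hs.1.le hs.2.le)
        (hβ.mix hβ' hs.1.le hs.2.le)
      exact ⟨U, V, hU.mono (le_max_right _ _), hV.mono (le_max_right _ _), fun _ _ => hUV⟩
    · exact ⟨u, v, hu, hv, fun h0 h1 => absurd ⟨h0, h1⟩ hs⟩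
  choose U V hU hV hUV using hex
  set G := ∫ x, u x ∂(α' : Measure (Rd d)) - ∫ x, u x ∂(α : Measure (Rd d)) +
          (∫ y, v y ∂(β' : Measure (Rd d)) - ∫ y, v y ∂(β : Measure (Rd d))) with hG
  set Gs : ℝ → ℝ := fun s => ∫ x, U s x ∂(α' : Measure (Rd d)) -
    ∫ x, U s x ∂(α : Measure (Rd d)) +
    (∫ y, V s y ∂(β' : Measure (Rd d)) - ∫ y, V s y ∂(β : Measure (Rd d))) with hGs
  set W₀ := dualValue ε (α : Measure (Rd d)) β u v with hW₀
  set W : ℝ → ℝ := fun s => dualValue ε (A s) (B s) (U s) (V s) with hW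
  set D : ℝ → ℝ := fun s => dualValue ε (α : Measure (Rd d)) β (U s) (V s) with hDdef
  set lo : ℝ → ℝ := fun s => ∫ x, mixLog ε (β' : Measure (Rd d)) u v s x ∂(α' : Measure (Rd d))
    with hlo
  set e : ℝ → ℝ := fun s => s * ∫ z, density ε (U s) (V s) z ∂((α' : Measure (Rd d)).prod β')
    with he
  have hid : Tendsto (fun s : ℝ => s) (𝓝[>] 0) (𝓝 0) := tendsto_id.mono_left nhdsWithin_le_nhds
  have hev : ∀ᶠ s : ℝ in 𝓝[>] 0, s ∈ Set.Ioo (0 : ℝ) 1 := Ioo_mem_nhdsGT (by norm_num)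
  have base := fun s (h0 : 0 < s) (h1 : s < 1) =>
    dualValue_base_eq hε hη hα hα' hβ hβ' h0 h1 (hU s) (hV s) (hUV s h0 h1)
  have tlo : Tendsto lo (𝓝[>] 0) (𝓝 0) := tendsto_integral_mixLog hε hη hα' hβ' hu hv
  have te : Tendsto e (𝓝[>] 0) (𝓝 0) := tendsto_mul_integral_density hε hη hβ hβ' hU hV
    fun s h0 h1 => ⟨(hUV s h0 h1).left, (base s h0 h1).2.1⟩
  have hDle : ∀ s, 0 < s → s < 1 → D s ≤ W₀ := fun s h0 h1 =>
    h.dualValue_le hε hη hα hβ hu hv (hU s) (hV s) (base s h0 h1).1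
  set q : ℝ → ℝ := fun s => (s - e s) / (1 - s) ^ 2 with hq
  have tq : Tendsto q (𝓝[>] 0) (𝓝 0) := by
    have := (hid.sub te).div ((hid.const_sub 1).pow 2) (by norm_num)
    simp only [sub_self, zero_div] at this
    exact this
  have hDeq : ∀ s, 0 < s → s < 1 → D s = W s - s * Gs s + s * q s := fun s h0 h1 => by
    rw [hDdef, hq]
    simp only
    rw [(base s h0 h1).2.2]
    simp only [he]
    ring
  have hWge : ∀ s, 0 < s → s < 1 → W₀ + s * G - s * lo s ≤ W s := fun s h0 h1 =>
    dualValue_mix_ge hε hη hα hα' hβ hβ' hu hv h h0 h1 (hU s) (hV s) (hUV s h0 h1)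
  have hGsb : ∀ s, Gs s ≤ 4 * ((2 * L + 1 / ε) * (1 + M / η)) := fun s => by
    have h1 := abs_le.1 ((hU s).abs_integral_le hε hη hα)
    have h2 := abs_le.1 ((hU s).abs_integral_le hε hη hα')
    have h3 := abs_le.1 ((hV s).abs_integral_le hε hη hβ)
    have h4 := abs_le.1 ((hV s).abs_integral_le hε hη hβ')
    simp only [hGs]
    linarith [h1.1, h2.2, h3.1, h4.2]
  -- Boundedness of `Gs` suffices here: the displaced potentials nearly maximize the base objective,
  -- which is the input of the stability lemma.
  have tD : Tendsto D (𝓝[>] 0) (𝓝 W₀) := by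
    have tl : Tendsto (fun s => W₀ + s * G - s * lo s -
        s * (4 * ((2 * L + 1 / ε) * (1 + M / η))) + s * q s) (𝓝[>] 0) (𝓝 W₀) := by
      have := ((((hid.mul_const G).const_add W₀).sub (hid.mul tlo)).sub
        (hid.mul_const (4 * ((2 * L + 1 / ε) * (1 + M / η))))).add (hid.mul tq)
      simpa using this
    refine tendsto_of_tendsto_of_tendsto_of_le_of_le' tl tendsto_const_nhds ?_ ?_
    · filter_upwards [hev] with s hs
      rw [hDeq s hs.1 hs.2]
      have := mul_le_mul_of_nonneg_left (hGsb s) hs.1.le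
      have := hWge s hs.1 hs.2
      linarith
    · filter_upwards [hev] with s hs
      exact hDle s hs.1 hs.2
  -- Along subsequences the potentials converge up to a constant k, which cancels in differences of
  -- probability measures.
  have tG : Tendsto Gs (𝓝[>] 0) (𝓝 G) := by
    refine tendsto_of_subseq_tendsto fun ns hns => ?_
    obtain ⟨N, hN⟩ := eventually_atTop.1 (hns.eventually hev)
    set σ : ℕ → ℝ := fun n => ns (n + N) with hσ
    have hσb : ∀ n, 0 < σ n ∧ σ n < 1 := fun n => hN _ (Nat.le_add_left _ _)
    have hσt : Tendsto σ atTop (𝓝[>] 0) := hns.comp (tendsto_add_atTop_nat N)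
    obtain ⟨φ, -, k, hUk, hVk⟩ := exists_subseq_tendsto_potentials hε hη hα hα' hβ hβ' hu hv h
      hσb (hid.comp hσt) (fun n => hU (σ n)) (fun n => hV (σ n))
      (fun n => hUV (σ n) (hσb n).1 (hσb n).2)
      (fun n => (base (σ n) (hσb n).1 (hσb n).2).1) (tD.comp hσt)
    refine ⟨fun n => φ n + N, ?_⟩
    have t := ((tendsto_integral_of_tame hε hη hα' (fun n => hU _) (ae_of_all _ hUk)).sub
      (tendsto_integral_of_tame hε hη hα (fun n => hU _) (ae_of_all _ hUk))).add
      ((tendsto_integral_of_tame hε hη hβ' (fun n => hV _) (ae_of_all _ hVk)).sub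
      (tendsto_integral_of_tame hε hη hβ (fun n => hV _) (ae_of_all _ hVk)))
    refine t.trans (le_of_eq ?_)
    congr 1
    rw [integral_sub (hu.integrable hε hη hα') (integrable_const _),
      integral_sub (hu.integrable hε hη hα) (integrable_const _),
      integral_add (hv.integrable hε hη hβ') (integrable_const _),
      integral_add (hv.integrable hε hη hβ) (integrable_const _)]
    simp only [integral_const, probReal_univ, smul_eq_mul, one_mul, hG]
    ring
  have hcε : 0 < c / ε := by positivity
  have tup : Tendsto (fun s => Gs s - G - q s) (𝓝[>] 0) (𝓝 0) := by
    simpa using (tG.sub_const G).sub tq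
  have hfinal := (hev.and (tlo.eventually (gt_mem_nhds hcε))).and
    (tup.eventually (gt_mem_nhds hcε))
  obtain ⟨r, hr, hsub⟩ := mem_nhdsGT_iff_exists_Ioo_subset.1 hfinal
  refine ⟨r, hr, fun s h0 hsr αs βs hαs hβs => ?_⟩
  obtain ⟨⟨⟨-, h1⟩, hlos⟩, hups⟩ := hsub ⟨h0, hsr⟩
  have hmα := hα.mix hα' h0.le h1.le
  have hmβ := hβ.mix hβ' h0.le h1.le
  have hpair := hUV s h0 h1
  simp only [hA, hB] at hpair
  rw [← hαs] at hmα hpair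
  rw [← hβs] at hmβ hpair
  rw [hpair.toReal_entropicOT hε hη hmα hmβ (hU s) (hV s), h.toReal_entropicOT hε hη hα hβ hu hv,
    hαs, hβs]
  have hWs : dualValue ε (mix s (α : Measure (Rd d)) α') (mix s (β : Measure (Rd d)) β')
    (U s) (V s) = W s := rfl
  rw [hWs]
  have hd := hDle s h0 h1
  rw [hDeq s h0 h1] at hd
  have hw := hWge s h0 h1
  -- The lower side is the updated base pair (`hw`), the upper side the displaced pair at the base
  -- measures (`hd`).
  have hab : |W s - W₀ - s * G| ≤ s * (c / ε) := by
    rw [abs_le]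
    constructor
    · have := mul_le_mul_of_nonneg_left hlos.le h0.le
      linarith
    · have := mul_le_mul_of_nonneg_left hups.le h0.le
      linarith
  have hfac : ε * W s - ε * W₀ - s * (ε * G) = ε * (W s - W₀ - s * G) := by ring
  rw [hfac, abs_mul, abs_of_pos hε]
  calc ε * |W s - W₀ - s * G| ≤ ε * (s * (c / ε)) := by gcongr
    _ = c * s := by field_simp

/-! ### Signed displacements and the Jordan pairing -/

section Pairing

/-- The Jordan parts are the truncated differences μ - ν and ν - μ, dominated by μ and ν, and μ + (ν
- μ) = ν + (μ - ν). -/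
lemma pairing_toSignedMeasure_sub (μ ν : Measure (Rd d)) [IsFiniteMeasure μ] [IsFiniteMeasure ν]
    {f : Rd d → ℝ} (hμ : Integrable f μ) (hν : Integrable f ν) :
    pairing (μ.toSignedMeasure - ν.toSignedMeasure) f = ∫ x, f x ∂μ - ∫ x, f x ∂ν := by
  rw [pairing, Measure.toJordanDecomposition_toSignedMeasure_sub,
    Measure.jordanDecompositionOfToSignedMeasureSub_posPart,
    Measure.jordanDecompositionOfToSignedMeasureSub_negPart]
  have h := Measure.sub_toSignedMeasure_eq_toSignedMeasure_sub (μ := μ) (ν := ν)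
  rw [sub_eq_sub_iff_add_eq_add, ← Measure.toSignedMeasure_add, ← Measure.toSignedMeasure_add,
    Measure.toSignedMeasure_eq_toSignedMeasure_iff] at h
  have h2 := congrArg (fun ρ => ∫ x, f x ∂ρ) h
  rw [integral_add_measure hμ (hν.mono_measure Measure.sub_le),
    integral_add_measure (hμ.mono_measure Measure.sub_le) hν] at h2
  linarith

lemma pairing_smul_signed_sub (μ ν : ProbabilityMeasure (Rd d)) {f : Rd d → ℝ}
    (hμ : Integrable f (μ : Measure (Rd d))) (hν : Integrable f (ν : Measure (Rd d))) (a : ℝ) :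
    pairing (a • (signed μ - signed ν)) f =
      a * (∫ x, f x ∂(μ : Measure (Rd d)) - ∫ x, f x ∂(ν : Measure (Rd d))) := by
  have key : ∀ (b : NNReal) (μ ν : ProbabilityMeasure (Rd d)),
      Integrable f (μ : Measure (Rd d)) → Integrable f (ν : Measure (Rd d)) →
      pairing ((b : ℝ) • (signed μ - signed ν)) f =
      b * (∫ x, f x ∂(μ : Measure (Rd d)) - ∫ x, f x ∂(ν : Measure (Rd d))) := by
    intro b μ ν hμ hν
    have : (b : ℝ) • (signed μ - signed ν) = (b • (μ : Measure (Rd d))).toSignedMeasure -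
        (b • (ν : Measure (Rd d))).toSignedMeasure := by
      rw [Measure.toSignedMeasure_smul, Measure.toSignedMeasure_smul, smul_sub]
      rfl
    rw [this, pairing_toSignedMeasure_sub _ _ hμ.smul_measure_nnreal hν.smul_measure_nnreal,
      integral_smul_nnreal_measure, integral_smul_nnreal_measure, ← smul_sub]
    rfl
  rcases le_total 0 a with ha | ha
  · exact key ⟨a, ha⟩ μ ν hμ hν
  · have := key ⟨-a, by linarith⟩ ν μ hν hμ
    change pairing ((-a) • (signed ν - signed μ)) f = -a * _ at this
    rw [show a • (signed μ - signed ν) = (-a) • (signed ν - signed μ) by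
      ext i hi
      simp only [_root_.smul_apply, _root_.sub_apply, smul_eq_mul]
      ring, this]
    ring

lemma signed_injective : Function.Injective (signed (d := d)) := fun μ ν h =>
  Subtype.ext ((Measure.toSignedMeasure_eq_toSignedMeasure_iff (μ := (μ : Measure (Rd d)))
    (ν := (ν : Measure (Rd d)))).1 h)

lemma coe_eq_mix_of_signed_eq {s : ℝ} (h0 : 0 ≤ s) (h1 : s ≤ 1)
    {μ μ' ρ : ProbabilityMeasure (Rd d)}
    (h : signed ρ = signed μ + s • (signed μ' - signed μ)) :
    (ρ : Measure (Rd d)) = mix s (μ : Measure (Rd d)) μ' := by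
  ext i hi
  have hv := congrArg (fun η : SignedMeasure (Rd d) => η i) h
  simp only [signed, _root_.add_apply, _root_.smul_apply, _root_.sub_apply,
    Measure.toSignedMeasure_apply_measurable hi, smul_eq_mul, measureReal_def] at hv
  have := isProbabilityMeasure_mix (μ := (μ : Measure (Rd d))) (μ' := μ') h0 h1
  rw [← ENNReal.toReal_eq_toReal_iff' (measure_ne_top _ _) (measure_ne_top _ _), hv, mix,
    Measure.add_apply, Measure.smul_apply, Measure.smul_apply, smul_eq_mul, smul_eq_mul,
    ENNReal.toReal_add (by finiteness) (by finiteness), ENNReal.toReal_mul, ENNReal.toReal_mul,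
    ENNReal.toReal_ofReal (by linarith), ENNReal.toReal_ofReal h0]
  ring

end Pairing

/-! ### Sub-Gaussian measures and arbitrary solutions of the system -/

section SubGaussian

lemma exists_hasExpSqMoment {μ : ProbabilityMeasure (Rd d)} (h : μ ∈ subGaussian d) :
    ∃ η : ℝ, 0 < η ∧ HasExpSqMoment η 2 (μ : Measure (Rd d)) := by
  obtain ⟨σ, hσ, hμ⟩ := h
  obtain ⟨η, hη, he⟩ : ∃ η : ℝ, 0 < η ∧ ∀ x : Rd d, ‖x‖ ^ 2 / (2 * d * σ ^ 2) = η * ‖x‖ ^ 2 := by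
    rcases Nat.eq_zero_or_pos d with rfl | hd
    -- In dimension 0 the denominator vanishes, but so does ‖x‖: any exponent works.
    · refine ⟨1, one_pos, fun x => ?_⟩
      rw [Subsingleton.elim x 0]
      simp
    · have : (0 : ℝ) < d := by exact_mod_cast hd
      exact ⟨1 / (2 * d * σ ^ 2), by positivity, fun x => by ring⟩
  unfold IsSubGaussianWith at hμ
  simp only [he] at hμ
  have hi : Integrable (fun x => Real.exp (η * ‖x‖ ^ 2)) (μ : Measure (Rd d)) := by
    refine (lintegral_ofReal_ne_top_iff_integrable ?_ (ae_of_all _ fun x => Real.exp_nonneg _)).1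
      (ne_top_of_le_ne_top (by norm_num) hμ)
    exact (by fun_prop : Continuous fun x : Rd d => Real.exp (η * ‖x‖ ^ 2)).aestronglyMeasurable
  refine ⟨η, hη, hi, ?_⟩
  rw [← ofReal_integral_eq_lintegral_ofReal hi (ae_of_all _ fun x => Real.exp_nonneg _)] at hμ
  have := ENNReal.toReal_mono (by norm_num) hμ
  rwa [ENNReal.toReal_ofReal (integral_nonneg fun x => Real.exp_nonneg _)] at this

lemma SchrodingerSystem.symm {α β : ProbabilityMeasure (Rd d)} {f g : Rd d → ℝ}
    (h : SchrodingerSystem ε α β f g) : SchrodingerSystem ε β α g f := by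
  have hs : ∀ x y : Rd d, gibbs ε x y = gibbs ε y x := fun x y => by
    simp [gibbs, cost, norm_sub_rev]
  refine ⟨fun y => ?_, fun x => ?_⟩
  · simpa only [hs y] using h.2 y
  · simpa only [hs _ x] using h.1 x

lemma gibbs_mul_exp (f : Rd d → ℝ) (x y : Rd d) :
    gibbs ε x y * Real.exp (f y / ε) = Real.exp (f y / ε - scaledCost ε y x) := by
  rw [gibbs, ← Real.exp_add, scaledCost_comm]
  simp only [cost, scaledCost]
  ring_nf

lemma SchrodingerSystem.integral_eq {α β : ProbabilityMeasure (Rd d)} {f g : Rd d → ℝ}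
    (h : SchrodingerSystem ε α β f g) (x : Rd d) :
    ∫ y, Real.exp (g y / ε - scaledCost ε y x) ∂(β : Measure (Rd d)) = Real.exp (-(f x / ε)) := by
  have := h.1 x
  simp only [gibbs_mul_exp] at this
  rw [Real.exp_neg]
  exact eq_inv_of_mul_eq_one_right this

lemma SchrodingerSystem.eq_softTransform {α β : ProbabilityMeasure (Rd d)} {f g : Rd d → ℝ}
    (h : SchrodingerSystem ε α β f g) :
    (fun x => f x / ε) = softTransform ε β (fun y => g y / ε) := by
  funext x
  rw [softTransform, h.integral_eq x, Real.log_exp, neg_neg]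

lemma SchrodingerSystem.isPotentialPair {α β : ProbabilityMeasure (Rd d)} {f g : Rd d → ℝ}
    (h : SchrodingerSystem ε α β f g) :
    IsPotentialPair ε (α : Measure (Rd d)) β (fun x => f x / ε) (fun y => g y / ε) :=
  ⟨h.eq_softTransform, h.symm.eq_softTransform⟩

lemma SchrodingerSystem.integrable {α β : ProbabilityMeasure (Rd d)} {f g : Rd d → ℝ}
    (h : SchrodingerSystem ε α β f g) (x : Rd d) :
    Integrable (fun y => Real.exp (g y / ε - scaledCost ε y x)) (β : Measure (Rd d)) :=
  Integrable.of_integral_ne_zero (by rw [h.integral_eq x]; exact (Real.exp_pos _).ne')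

/-- Measurability of a solution is not assumed: it is recovered by taking the logarithm of an
integrand that must be integrable. -/
lemma SchrodingerSystem.aestronglyMeasurable {α β : ProbabilityMeasure (Rd d)} {f g : Rd d → ℝ}
    (h : SchrodingerSystem ε α β f g) :
    AEStronglyMeasurable (fun y => g y / ε) (β : Measure (Rd d)) := by
  have h1 := Real.measurable_log.comp_aemeasurable (h.integrable 0).aemeasurable
  have h2 := h1.add (measurable_scaledCost (d := d) ε measurable_id
    (measurable_const (a := 0))).aemeasurable
  refine (h2.congr (ae_of_all _ fun y => ?_)).aestronglyMeasurable
  simp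

/-- Jensen is not available before g is known to be integrable. Instead the integral equal to
exp(-f/ε) is restricted to a ball of positive β-mass, where c(y, x) ≤ c(y, 0) + (2n‖x‖ + ‖x‖²)/ε. -/
lemma SchrodingerSystem.exists_upper {α β : ProbabilityMeasure (Rd d)} {f g : Rd d → ℝ}
    (hε : 0 < ε) (h : SchrodingerSystem ε α β f g) :
    ∃ K : ℝ, 0 ≤ K ∧ ∀ x, f x / ε ≤ ‖x‖ ^ 2 / ε + K * (1 + ‖x‖) := by
  obtain ⟨n, hn⟩ : ∃ n : ℕ, (β : Measure (Rd d)) (Metric.closedBall 0 (n : ℝ)) ≠ 0 := by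
    by_contra! hall
    have := measure_iUnion_null hall
    rw [Metric.iUnion_closedBall_nat] at this
    simp at this
  set ball : Set (Rd d) := Metric.closedBall 0 (n : ℝ) with hball
  have : NeZero ((β : Measure (Rd d)).restrict ball) :=
    ⟨fun h0 => hn (Measure.restrict_eq_zero.1 h0)⟩
  set I := ∫ y in ball, Real.exp (g y / ε - scaledCost ε y 0) ∂(β : Measure (Rd d)) with hI
  have hIpos : 0 < I := integral_exp_pos (h.integrable 0).integrableOn
  refine ⟨2 * n / ε + |Real.log I|, by positivity, fun x => ?_⟩
  have hle : Real.exp (-((2 * n * ‖x‖ + ‖x‖ ^ 2) / ε)) * I ≤ Real.exp (-(f x / ε)) := by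
    rw [← h.integral_eq x, hI, ← integral_const_mul]
    refine le_trans ?_ (setIntegral_le_integral (s := ball) (h.integrable x)
      (ae_of_all _ fun y => Real.exp_nonneg _))
    refine setIntegral_mono_on ((h.integrable 0).const_mul _).integrableOn
      (h.integrable x).integrableOn Metric.isClosed_closedBall.measurableSet fun y hy => ?_
    rw [← Real.exp_add]
    refine Real.exp_le_exp.2 ?_
    have hy' : ‖y‖ ≤ n := by simpa [hball] using hy
    have h1 := scaledCost_le hε y x
    have h2 : (‖y‖ ^ 2 + 2 * ‖y‖ * ‖x‖ + ‖x‖ ^ 2) / ε ≤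
        scaledCost ε y 0 + (2 * n * ‖x‖ + ‖x‖ ^ 2) / ε := by
      rw [scaledCost, sub_zero, ← add_div]
      refine (div_le_div_iff_of_pos_right hε).2 ?_
      nlinarith [mul_le_mul_of_nonneg_right hy' (norm_nonneg x)]
    linarith
  have hlog := Real.log_le_log (by positivity) hle
  rw [Real.log_mul (Real.exp_pos _).ne' hIpos.ne', Real.log_exp, Real.log_exp] at hlog
  have e1 : (2 * n * ‖x‖ + ‖x‖ ^ 2) / ε = 2 * n / ε * ‖x‖ + ‖x‖ ^ 2 / ε := by ring
  rw [e1] at hlog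
  have := neg_abs_le (Real.log I)
  have h3 : 0 ≤ 2 * n / ε := by positivity
  nlinarith [mul_nonneg (abs_nonneg (Real.log I)) (norm_nonneg x)]

lemma SchrodingerSystem.exists_tame {α β : ProbabilityMeasure (Rd d)} {f g : Rd d → ℝ}
    (hε : 0 < ε) (hη : 0 < η) (hβ : HasExpSqMoment η M (β : Measure (Rd d)))
    (h : SchrodingerSystem ε α β f g) :
    Continuous f ∧ ∃ K, Tame ε K fun x => f x / ε := by
  obtain ⟨K, hK, hgu⟩ := h.symm.exists_upper hε
  obtain ⟨L, hL, hfu⟩ := h.exists_upper hε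
  have hc := continuous_softTransform hε hη hβ h.aestronglyMeasurable hgu
  have hlow := softTransform_ge hε hη hβ h.aestronglyMeasurable hK hgu
  rw [← h.eq_softTransform] at hc hlow
  refine ⟨?_, max (Real.log M + K + K ^ 2 / (2 * η) + 2 / (ε ^ 2 * η)) L, hc.measurable,
    fun x => le_trans ?_ (hlow x), fun x => (hfu x).trans ?_⟩
  · have := hc.mul_const ε
    simpa [div_mul_cancel₀ _ hε.ne'] using this
  · refine neg_le_neg (mul_le_mul_of_nonneg_right (le_max_left _ _) (by positivity))
  · gcongr
    exact le_max_right _ _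

lemma IsPotentialPair.schrodingerSystem {α β : ProbabilityMeasure (Rd d)} (hε : 0 < ε)
    (hη : 0 < η) (hα : HasExpSqMoment η M (α : Measure (Rd d)))
    (hβ : HasExpSqMoment η M (β : Measure (Rd d))) {u v : Rd d → ℝ} (hu : Tame ε K u)
    (hv : Tame ε K v) (h : IsPotentialPair ε (α : Measure (Rd d)) β u v) :
    SchrodingerSystem ε α β (fun x => ε * u x) (fun y => ε * v y) := by
  have key : ∀ (ρ : ProbabilityMeasure (Rd d)) (a b : Rd d → ℝ),
      HasExpSqMoment η M (ρ : Measure (Rd d)) → Tame ε K b → a = softTransform ε ρ b → ∀ x,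
      Real.exp (ε * a x / ε) *
        ∫ y, gibbs ε x y * Real.exp (ε * b y / ε) ∂(ρ : Measure (Rd d)) = 1 := by
    intro ρ a b hρ hb hab x
    have e1 : ∀ r : ℝ, ε * r / ε = r := fun r => mul_div_cancel_left₀ r hε.ne'
    have e2 : ∀ y, gibbs ε x y * Real.exp (ε * b y / ε) = Real.exp (b y - scaledCost ε y x) :=
      fun y => (gibbs_mul_exp (fun y => ε * b y) x y).trans (by simp only [e1])
    simp only [e2]
    rw [e1]
    rw [← hb.exp_neg_softTransform hε hη hρ, ← hab, ← Real.exp_add]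
    simp
  refine ⟨key β u v hβ hv h.left, fun y => ?_⟩
  have hs : ∀ x : Rd d, gibbs ε x y = gibbs ε y x := fun x => by
    simp [gibbs, cost, norm_sub_rev]
  simp only [hs]
  exact key α v u hα hu h.right y

end SubGaussian

end

/-! ### Feasible displacements and conclusion -/

/-- The derivative of the entropic cost along feasible displacements `t` of the sign of a given
feasible displacement `t₀`. -/
lemma exists_forall_abs_sub_le_of_feasible {d : ℕ} {ε η M K c t₀ : ℝ} (hε : 0 < ε) (hη : 0 < η)
    (hc : 0 < c) (ht₀ : t₀ ≠ 0) {α β α₀ β₀ : ProbabilityMeasure (Rd d)}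
    (hα : HasExpSqMoment η M (α : Measure (Rd d)))
    (hα₀ : HasExpSqMoment η M (α₀ : Measure (Rd d)))
    (hβ : HasExpSqMoment η M (β : Measure (Rd d)))
    (hβ₀ : HasExpSqMoment η M (β₀ : Measure (Rd d))) {f g : Rd d → ℝ}
    (hf : Tame ε K fun x => f x / ε) (hg : Tame ε K fun x => g x / ε)
    (h : SchrodingerSystem ε α β f g) {δα δβ : SignedMeasure (Rd d)}
    (eα : signed α₀ = signed α + t₀ • δα) (eβ : signed β₀ = signed β + t₀ • δβ) :
    ∃ r : ℝ, 0 < r ∧ ∀ t : ℝ, |t| < r → 0 < t / t₀ → ∀ α' β' : ProbabilityMeasure (Rd d),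
      signed α' = signed α + t • δα → signed β' = signed β + t • δβ →
      |(entropicOT ε α' β').toReal - (entropicOT ε α β).toReal
          - t * (pairing δα f + pairing δβ g)| ≤ c * |t| := by
  have ht₀' : 0 < |t₀| := abs_pos.2 ht₀
  obtain ⟨r, hr, hmain⟩ := exists_forall_abs_entropicOT_sub_le hε hη hα hα₀ hβ hβ₀ hf hg
    h.isPotentialPair (mul_pos hc ht₀')
  refine ⟨min r 1 * |t₀|, by positivity, fun t ht hpos α' β' hα' hβ' => ?_⟩
  have habs : |t| / |t₀| = t / t₀ := by rw [← abs_div, abs_of_pos hpos]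
  have hlt : t / t₀ < min r 1 := by
    rw [← habs, div_lt_iff₀ ht₀']
    exact ht
  -- Rewriting δα through two sub-Gaussian measures makes its pairing with f computable, although
  -- the measures it was first built from may not integrate f.
  have dα : δα = t₀⁻¹ • (signed α₀ - signed α) := by
    rw [eα, add_sub_cancel_left, smul_smul, inv_mul_cancel₀ ht₀, one_smul]
  have dβ : δβ = t₀⁻¹ • (signed β₀ - signed β) := by
    rw [eβ, add_sub_cancel_left, smul_smul, inv_mul_cancel₀ ht₀, one_smul]
  have hint : ∀ {φ : Rd d → ℝ}, (Tame ε K fun x => φ x / ε) →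
      ∀ {ρ : ProbabilityMeasure (Rd d)}, HasExpSqMoment η M (ρ : Measure (Rd d)) →
      Integrable φ (ρ : Measure (Rd d)) := by
    intro φ hφ ρ hρ
    refine ((hφ.integrable hε hη hρ).const_mul ε).congr (ae_of_all _ fun x => ?_)
    exact mul_div_cancel₀ (φ x) hε.ne'
  have key := hmain (t / t₀) hpos (hlt.trans_le (min_le_left _ _)) α' β'
    (coe_eq_mix_of_signed_eq hpos.le (hlt.trans_le (min_le_right _ _)).le
      (by rw [hα', dα, smul_smul, div_eq_mul_inv]))
    (coe_eq_mix_of_signed_eq hpos.le (hlt.trans_le (min_le_right _ _)).le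
      (by rw [hβ', dβ, smul_smul, div_eq_mul_inv]))
  rw [dα, dβ, pairing_smul_signed_sub _ _ (hint hf hα₀) (hint hf hα),
    pairing_smul_signed_sub _ _ (hint hg hβ₀) (hint hg hβ)]
  simp only [integral_div] at key
  convert key using 1
  · congr 2
    field_simp
  · rw [← habs]
    field_simp

end SinkhornOT

theorem mainTheorem4 (d : ℕ) (ε : ℝ) (hε : 0 < ε)
    (α β : ProbabilityMeasure (SinkhornOT.Rd d))
    (hα : α ∈ SinkhornOT.subGaussian d) (hβ : β ∈ SinkhornOT.subGaussian d) :
    SinkhornOT.entropicOT ε α β ≠ ∞ ∧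
    (∃ f g : SinkhornOT.Rd d → ℝ, SinkhornOT.SchrodingerSystem ε α β f g) ∧
    ∀ f g : SinkhornOT.Rd d → ℝ, SinkhornOT.SchrodingerSystem ε α β f g →
      SinkhornOT.IsGradientAt (SinkhornOT.subGaussian d)
        (fun μ ν => (SinkhornOT.entropicOT ε μ ν).toReal) α β f g := by
  open SinkhornOT in
  obtain ⟨η₁, hη₁, hm₁⟩ := exists_hasExpSqMoment hα
  obtain ⟨η₂, hη₂, hm₂⟩ := exists_hasExpSqMoment hβ
  have hη : 0 < min η₁ η₂ := lt_min hη₁ hη₂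
  replace hm₁ := hm₁.mono_exponent (min_le_left η₁ η₂)
  replace hm₂ := hm₂.mono_exponent (min_le_right η₁ η₂)
  obtain ⟨K₀, hK₀⟩ := exists_potentialPair (d := d) hε hη 2
  obtain ⟨u, v, hu, hv, huv⟩ := hK₀ _ _ hm₁ hm₂
  refine ⟨?_, ⟨_, _, huv.schrodingerSystem hε hη hm₁ hm₂ hu hv⟩, fun f g h => ?_⟩
  · rw [(entropicOT_eq hε hη hm₁ hm₂ hu hv huv).2]
    exact ENNReal.ofReal_ne_top
  obtain ⟨cf, K₁, hf⟩ := h.exists_tame hε hη hm₂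
  obtain ⟨cg, K₂, hg⟩ := h.symm.exists_tame hε hη hm₁
  replace hf := hf.mono (le_max_left K₁ K₂)
  replace hg := hg.mono (le_max_right K₁ K₂)
  refine ⟨cf, cg, fun μ hμ => ?_, fun α₁ α₂ β₁ β₂ c hc => ?_⟩
  · obtain ⟨η, hη', hm⟩ := exists_hasExpSqMoment hμ
    constructor
    · refine ((hf.integrable hε hη' hm).const_mul ε).congr (ae_of_all _ fun x => ?_)
      exact mul_div_cancel₀ (f x) hε.ne'
    · refine ((hg.integrable hε hη' hm).const_mul ε).congr (ae_of_all _ fun x => ?_)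
      exact mul_div_cancel₀ (g x) hε.ne'
  set δα := signed α₁ - signed α₂
  set δβ := signed β₁ - signed β₂
  -- The values σ = ±1 select the sign of t. One feasible t₀ of that sign exhibits the smaller
  -- feasible displacements as mixtures; if there is none, the claim is vacuous.
  have side : ∀ σ : ℝ, ∃ r : ℝ, 0 < r ∧ ∀ t : ℝ, |t| < r → 0 < t * σ →
      ∀ α' ∈ subGaussian d, ∀ β' ∈ subGaussian d, signed α' = signed α + t • δα →
      signed β' = signed β + t • δβ →
      |(entropicOT ε α' β').toReal - (entropicOT ε α β).toReal
          - t * (pairing δα f + pairing δβ g)| ≤ c * |t| := by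
    intro σ
    by_cases hex : ∃ t₀ : ℝ, 0 < t₀ * σ ∧ ∃ α₀ ∈ subGaussian d, ∃ β₀ ∈ subGaussian d,
        signed α₀ = signed α + t₀ • δα ∧ signed β₀ = signed β + t₀ • δβ
    · obtain ⟨t₀, ht₀, α₀, hα₀, β₀, hβ₀, eα, eβ⟩ := hex
      obtain ⟨η₃, hη₃, hm₃⟩ := exists_hasExpSqMoment hα₀
      obtain ⟨η₄, hη₄, hm₄⟩ := exists_hasExpSqMoment hβ₀
      have hle : min (min η₁ η₂) (min η₃ η₄) ≤ min η₁ η₂ := min_le_left _ _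
      obtain ⟨r, hr, hmain⟩ := exists_forall_abs_sub_le_of_feasible hε
        (lt_min hη (lt_min hη₃ hη₄)) hc (left_ne_zero_of_mul ht₀.ne') (hm₁.mono_exponent hle)
        (hm₃.mono_exponent ((min_le_right _ _).trans (min_le_left η₃ η₄)))
        (hm₂.mono_exponent hle)
        (hm₄.mono_exponent ((min_le_right _ _).trans (min_le_right η₃ η₄))) hf hg h eα eβ
      refine ⟨r, hr, fun t ht hts α' _ β' _ => hmain t ht ?_ α' β'⟩
      have hσ : σ ≠ 0 := right_ne_zero_of_mul ht₀.ne'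
      rw [← mul_div_mul_right t t₀ hσ]
      exact div_pos hts ht₀
    · refine ⟨1, one_pos, fun t _ hts α' hα' β' hβ' e₁ e₂ => ?_⟩
      exact absurd ⟨t, hts, α', hα', β', hβ', e₁, e₂⟩ hex
  obtain ⟨r₁, hr₁, h₁⟩ := side 1
  obtain ⟨r₂, hr₂, h₂⟩ := side (-1)
  refine ⟨min r₁ r₂, lt_min hr₁ hr₂, fun t ht α' hα' β' hβ' e₁ e₂ => ?_⟩
  rcases lt_trichotomy t 0 with hneg | rfl | hpos
  · exact h₂ t (ht.trans_le (min_le_right _ _)) (by linarith) α' hα' β' hβ' e₁ e₂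
  · have hαα : α' = α := by
      rw [zero_smul, add_zero] at e₁
      exact signed_injective e₁
    have hββ : β' = β := by
      rw [zero_smul, add_zero] at e₂
      exact signed_injective e₂
    simp [hαα, hββ]
  · exact h₁ t (ht.trans_le (min_le_left _ _)) (by linarith) α' hα' β' hβ' e₁ e₂
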